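/- **Setting.** Let $N\ge 1$ be an even integer, $h=\sqrt2\,N^{-1/2}$, $A_h=h\mathbb Z\cap[-\tfrac1h,\tfrac1h]$, $\|u\|_{\ell^2(h\mathbb Z)}^2=h\sum_{a\in h\mathbb Z}|u(a)|^2$, and $(\pi_h g)(a)=g(a)$ for $a\in h\mathbb Z$. Let $\psi_n(x)=\pi^{-1/4}2^{-n/2}(n!)^{-1/2}e^{-x^2/2}H_n(x)$ be the Hermite functions, where $H_0=1$, $H_{n+1}=2xH_n-2nH_{n-1}$; they satisfy $H\psi_n=(2n+1)\psi_n$ for $H=-\partial_x^2+x^2$. Define $k_{0,h}=1$, $k_{n+1,h}(x)=2x\,k_{n,h}(x)-2n\bigl(1-h^2\tfrac{n-1}{2}\bigr)k_{n-1,h}(x)$ (with $k_{-1,h}=0$), and for $0\le n\le N$ the Kravchuk functions on $h\mathbb Z$ $$\varphi_{n,h}(a)=\frac1{h^n}\sqrt{\frac{(N-n)!}{N!\,n!}}\;k_{n,h}(a)\sqrt{\rho_h(a)},\qquad \rho_h(a)=\frac1{h2^N}\binom{N}{\frac N2+\frac ah}\ (a\in A_h),\quad \rho_h(a)=0\ (a\notin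 A_h).$$ Let $H_h$ be the operator on functions on $h\mathbb Z$ given by $$H_hu(a)=-\tfrac1{h^2}\sqrt{(1+ah+h^2)(1-ah)}\,u(a+h)-\tfrac1{h^2}\sqrt{(1-ah+h^2)(1+ah)}\,u(a-h)+\bigl(1+\tfrac2{h^2}\bigr)u(a)$$ for $a\in A_h$, and $H_hu(a)=0$ for $a\in h\mathbb Z\setminus A_h$. Let $f:\mathbb R\to\mathbb C$ be smooth in the sense that $f\in C^\infty$, $f^{(k)}\in L^2(\mathbb R)$ and $(1+x^2)^{k/2}f\in L^2(\mathbb R)$ for all $k\in\mathbb N$. Put $$\psi(t)=e^{-itH}f=\sum_{n\ge0}c_n e^{-i(2n+1)t}\psi_n,\quad c_n=\int_{\mathbb R} f\psi_n,\qquad \psi_h(t)=\sum_{n=0}^{n_{\max}}c_{n,h}e^{-i(2n+1)t}\varphi_{n,h},\quad c_{n,h}=h\sum_{a\in A_h}f(a)\varphi_{n,h}(a).$$ **Theorem 4.** For every such $f$, the series defining $\psi(t,x)$ converges absolutely for all real $t,x$, and there is a constant $C$ such that for every $s\in\mathbb R$ there is a constant $C_s$ such that for every $\delta>0$ the following holds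 for all sufficiently small $h=\sqrt2\,N^{-1/2}$, $N$ even (how small may depend on $f$, $s$, $\delta$), and all $n_{\max}\in\mathbb N$ with $\tfrac14\delta|\log h|\le n_{\max}\le\tfrac13\delta|\log h|$: the function $\psi_h$ solves $i\partial_t\psi_h=H_h\psi_h$, and for all $t\ge0$, $\pi_h\psi(t)-\psi_h(t)\in\ell^2(h\mathbb Z)$ and $$\|\pi_h\psi(t)-\psi_h(t)\|_{\ell^2(h\mathbb Z)}\le C\,h^{2-\delta}+\frac{C_s}{|\log h|^{s}}.$$ -/

import Mathlib

open MeasureTheory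

noncomputable section

namespace Kravchuk

/-! ### The continuous harmonic oscillator -/

/-- Hermite polynomials: `H₀ = 1`, `H_{n+1} = 2 x H_n - 2 n H_{n-1}`. -/
def hermitePoly : ℕ → ℝ → ℝ
  | 0, _ => 1
  | 1, x => 2 * x
  | n + 2, x => 2 * x * hermitePoly (n + 1) x - 2 * ((n : ℝ) + 1) * hermitePoly n x

/-- `ψ_n(x) = π^{-1/4} 2^{-n/2} (n!)^{-1/2} e^{-x²/2} H_n(x)`. -/
def hermiteFun (n : ℕ) (x : ℝ) : ℝ :=
  1 / (Real.pi ^ (1 / 4 : ℝ) * (2 : ℝ) ^ ((n : ℝ) / 2) * √(n.factorial : ℝ))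
    * Real.exp (-x ^ 2 / 2) * hermitePoly n x

/-- `c_n(f) = ∫ f ψ_n`. -/
def hermiteCoeff (f : ℝ → ℂ) (n : ℕ) : ℂ := ∫ x : ℝ, f x * (hermiteFun n x : ℂ)

/-- The `n`-th term of the spectral expansion of `e^{-itH} f` at `x`, where `H = -∂ₓ² + x²`
and `H ψ_n = (2n+1) ψ_n`. -/
def evolutionTerm (f : ℝ → ℂ) (t x : ℝ) (n : ℕ) : ℂ :=
  hermiteCoeff f n * Complex.exp (-Complex.I * (2 * n + 1) * t) * (hermiteFun n x : ℂ)

/-- `ψ(t, x) = (e^{-itH} f)(x) = ∑ₙ c_n(f) e^{-i(2n+1)t} ψ_n(x)`. -/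
def evolution (f : ℝ → ℂ) (t x : ℝ) : ℂ := ∑' n : ℕ, evolutionTerm f t x n

/-- `f` belongs to every weighted Sobolev space
`Σⁿ = {g ∈ Hⁿ : ⟨x⟩ⁿ g ∈ L²}`, `⟨x⟩ = (1 + x²)^{1/2}`. As `⋂ Hⁿ(ℝ) ⊆ C^∞(ℝ)`, the function is
taken to be the smooth representative, and `Hⁿ` is expressed by classical derivatives. -/
structure IsSmooth (f : ℝ → ℂ) : Prop where
  contDiff : ContDiff ℝ (⊤ : ℕ∞) f
  memLp_deriv : ∀ k : ℕ, MemLp (iteratedDeriv k f) 2 volume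
  memLp_weight : ∀ k : ℕ, MemLp (fun x : ℝ => ((√(1 + x ^ 2) ^ k : ℝ) : ℂ) * f x) 2 volume

/-! ### The grid `hℤ` -/

/-- The grid `hℤ ⊆ ℝ`. -/
abbrev Grid (h : ℝ) : Type := AddSubgroup.zmultiples h

/-- The step `h`, as an element of `hℤ`. -/
def Grid.step (h : ℝ) : Grid h := ⟨h, AddSubgroup.mem_zmultiples h⟩

/-- Membership in `A_h = hℤ ∩ [-1/h, 1/h]`. -/
def InA (h : ℝ) (a : Grid h) : Prop := (a : ℝ) ∈ Set.Icc (-(1 / h)) (1 / h)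

/-- `u ∈ ℓ²(hℤ)`. -/
def MemEll2 (h : ℝ) (u : Grid h → ℂ) : Prop := Summable fun a => ‖u a‖ ^ 2

/-- `‖u‖_{ℓ²(hℤ)} = (h ∑_{a ∈ hℤ} |u(a)|²)^{1/2}`. -/
def ell2Norm (h : ℝ) (u : Grid h → ℂ) : ℝ := √(h * ∑' a : Grid h, ‖u a‖ ^ 2)

/-- `π_h g`: pointwise restriction to the grid. -/
def restrict (h : ℝ) (g : ℝ → ℂ) : Grid h → ℂ := fun a => g a

/-! ### Kravchuk functions and the Kravchuk oscillator -/

/-- `k_{0,h} = 1`, `k_{n+1,h} = 2 x k_{n,h} - 2 n (1 - h² (n-1)/2) k_{n-1,h}`. -/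
def kravchukPoly (h : ℝ) : ℕ → ℝ → ℝ
  | 0, _ => 1
  | 1, x => 2 * x
  | n + 2, x => 2 * x * kravchukPoly h (n + 1) x
      - 2 * ((n : ℝ) + 1) * (1 - h ^ 2 * ((n : ℝ) / 2)) * kravchukPoly h n x

open Classical in
/-- The rescaled binomial weight on `A_h`, extended by zero to `hℤ`. -/
def rho (h : ℝ) (a : Grid h) : ℝ :=
  if InA h a then
    1 / (h * (2 : ℝ) ^ (2 / h ^ 2)) *
      (Real.Gamma (1 + 2 / h ^ 2) /
        (Real.Gamma (1 + 1 / h ^ 2 + a / h) * Real.Gamma (1 + 1 / h ^ 2 - a / h)))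
  else 0

/-- The normalization constant `α_{n,h}`. -/
def alpha (n : ℕ) (h : ℝ) : ℝ :=
  1 / (h ^ n * √(n.factorial : ℝ)) *
    √(Real.Gamma (1 + 2 / h ^ 2 - n) / Real.Gamma (1 + 2 / h ^ 2))

/-- The Kravchuk function `φ_{n,h} = α_{n,h} k_{n,h} √ρ_h`. -/
def kravchukFun (n : ℕ) (h : ℝ) (a : Grid h) : ℝ :=
  alpha n h * kravchukPoly h n a * √(rho h a)

open Classical in
/-- The discrete Hamiltonian `H_h`. -/
def kravchukOscillator (h : ℝ) (u : Grid h → ℂ) (a : Grid h) : ℂ :=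
  if InA h a then
    -((1 / h ^ 2 * √((1 + a * h + h ^ 2) * (1 - a * h)) : ℝ) : ℂ) * u (a + Grid.step h)
      - ((1 / h ^ 2 * √((1 - a * h + h ^ 2) * (1 + a * h)) : ℝ) : ℂ) * u (a - Grid.step h)
      + ((1 + 2 / h ^ 2 : ℝ) : ℂ) * u a
  else 0

open Classical in
/-- `c_{n,h} = ⟨u, φ_{n,h}⟩_{ℓ²(hℤ)}` with `u = (π_h f) 1_{A_h}`. -/
def kravchukCoeff (f : ℝ → ℂ) (n : ℕ) (h : ℝ) : ℂ :=
  (h : ℂ) * ∑' a : Grid h, (if InA h a then restrict h f a else 0) * (kravchukFun n h a : ℂ)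

/-- `ψ_h(t) = ∑_{n ≤ nmax} c_{n,h} e^{-i(2n+1)t} φ_{n,h}`. -/
def discreteEvolution (f : ℝ → ℂ) (nmax : ℕ) (h t : ℝ) (a : Grid h) : ℂ :=
  ∑ n ∈ Finset.range (nmax + 1),
    kravchukCoeff f n h * Complex.exp (-Complex.I * (2 * n + 1) * t) * (kravchukFun n h a : ℂ)

/-- `Ψ` solves `i ∂ₜ Ψ = H_h Ψ` on `hℤ`. -/
def SolvesDiscreteSchrodinger (h : ℝ) (Ψ : ℝ → Grid h → ℂ) : Prop :=
  ∀ (t : ℝ) (a : Grid h),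
    HasDerivAt (fun τ => Ψ τ a) (-Complex.I * kravchukOscillator h (Ψ t) a) t

end Kravchuk

end

/-!
The Hermite coefficients `c_m` of a Schwartz function decay faster than any power of `m`, while the
restriction of `ψ_m` to the grid is an approximate eigenvector of `H_h` for `2m + 1`, with residual
`O(h²)` whose constant grows polynomially in `m`. The Kravchuk functions are an orthonormal
eigenbasis of `ℓ²(A_h)` whose eigenvalues are odd integers, hence `2`-separated, so expanding `ψ_m`
in this basis turns the residual into an error of the same size for the discrete evolution of `ψ_m`
when `m ≤ nmax`. When `m > nmax`, the trivial `ℓ²` bound on that error is `O(nmax ^ (-σ))` for every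
`σ` once it is multiplied by `c_m`. Both contributions are summable in `m`.
-/

namespace Kravchuk

open SchwartzMap

/-! ### Sobolev and interpolation inequalities on the line -/

section Line

variable {E : Type*} [NormedAddCommGroup E]

theorem norm_le_integral_norm_deriv [NormedSpace ℝ E] [CompleteSpace E] {g g' : ℝ → E}
    (hd : ∀ x, HasDerivAt g (g' x) x) (hg : Integrable g) (hg' : Integrable g') (x : ℝ) :
    ‖g x‖ ≤ ∫ y, ‖g' y‖ := by
  have hlim := tendsto_zero_of_hasDerivAt_of_integrableOn_Iic (a := x) (fun y _ => hd y)
    hg'.integrableOn hg.integrableOn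
  have hftc := integral_Iic_of_hasDerivAt_of_tendsto' (a := x) (fun y _ => hd y)
    hg'.integrableOn hlim
  rw [sub_zero] at hftc
  rw [← hftc]
  exact (norm_integral_le_integral_norm _).trans
    (setIntegral_le_integral hg'.norm (.of_forall fun y => norm_nonneg _))

theorem mul_norm_sq_le_integral [InnerProductSpace ℝ E] {f f' : ℝ → E} {w w' : ℝ → ℝ}
    (hf : ∀ x, HasDerivAt f (f' x) x) (hw : ∀ x, HasDerivAt w (w' x) x)
    (hf' : Continuous f') (hw' : Continuous w')
    (hwf : Integrable fun x => w x * ‖f x‖ ^ 2) (hw'f : Integrable fun x => w' x * ‖f x‖ ^ 2)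
    (hwwf : Integrable fun x => (w x * ‖f x‖) ^ 2) (hf'2 : Integrable fun x => ‖f' x‖ ^ 2)
    (x : ℝ) :
    w x * ‖f x‖ ^ 2 ≤ ∫ y, (|w' y| * ‖f y‖ ^ 2 + ((w y * ‖f y‖) ^ 2 + ‖f' y‖ ^ 2)) := by
  have hfc : Continuous f := continuous_iff_continuousAt.2 fun x => (hf x).continuousAt
  have hwc : Continuous w := continuous_iff_continuousAt.2 fun x => (hw x).continuousAt
  have hd (y : ℝ) := (hw y).mul (hf y).norm_sq
  have hbound (y : ℝ) : ‖w' y * ‖f y‖ ^ 2 + w y * (2 * inner ℝ (f y) (f' y))‖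
      ≤ |w' y| * ‖f y‖ ^ 2 + ((w y * ‖f y‖) ^ 2 + ‖f' y‖ ^ 2) := by
    refine (norm_add_le _ _).trans (add_le_add (by simp) ?_)
    have hinner := abs_real_inner_le_norm (f y) (f' y)
    calc ‖w y * (2 * inner ℝ (f y) (f' y))‖ = |w y| * (2 * |inner ℝ (f y) (f' y)|) := by
          simp
      _ ≤ |w y| * (2 * (‖f y‖ * ‖f' y‖)) := by gcongr
      _ = 2 * (|w y| * ‖f y‖) * ‖f' y‖ := by ring
      _ ≤ (|w y| * ‖f y‖) ^ 2 + ‖f' y‖ ^ 2 := two_mul_le_add_sq _ _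
      _ = (w y * ‖f y‖) ^ 2 + ‖f' y‖ ^ 2 := by rw [mul_pow, sq_abs, mul_pow]
  have hdom : Integrable fun y => |w' y| * ‖f y‖ ^ 2 + ((w y * ‖f y‖) ^ 2 + ‖f' y‖ ^ 2) := by
    refine Integrable.add ?_ (hwwf.add hf'2)
    simpa using hw'f.norm
  have hint := hdom.mono' (by fun_prop) (.of_forall hbound)
  calc w x * ‖f x‖ ^ 2 ≤ _ := le_abs_self _
    _ ≤ _ := norm_le_integral_norm_deriv hd hwf hint x
    _ ≤ _ := integral_mono hint.norm hdom hbound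

theorem norm_sq_le_integral [InnerProductSpace ℝ E] {f f' : ℝ → E}
    (hd : ∀ x, HasDerivAt f (f' x) x) (hf' : Continuous f')
    (hf2 : Integrable fun x => ‖f x‖ ^ 2) (hf'2 : Integrable fun x => ‖f' x‖ ^ 2) (x : ℝ) :
    ‖f x‖ ^ 2 ≤ ∫ y, (‖f y‖ ^ 2 + ‖f' y‖ ^ 2) := by
  simpa using mul_norm_sq_le_integral (w := fun _ => 1) (w' := fun _ => 0) hd
    (fun x => hasDerivAt_const x 1) hf' continuous_const (by simpa using hf2) (by simp)
    (by simpa using hf2) hf'2 x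

variable [NormedSpace ℝ E]

theorem norm_sub_sub_smul_deriv_le {g g' g'' : ℝ → E} (hd : ∀ x, HasDerivAt g (g' x) x)
    (hd' : ∀ x, HasDerivAt g' (g'' x) x) {B : ℝ} (hB : ∀ x, ‖g'' x‖ ≤ B) (x : ℝ) {η : ℝ}
    (hη : 0 ≤ η) : ‖g (x + η) - g x - η • g' x‖ ≤ B * η ^ 2 := by
  have hB0 : 0 ≤ B := (norm_nonneg _).trans (hB 0)
  have hmv := Convex.norm_image_sub_le_of_norm_hasDerivWithin_le
    (f := fun y => g y - (y - x) • g' x) (f' := fun y => g' y - g' x) (C := B * η)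
    (s := Set.Icc x (x + η)) (x := x) (y := x + η)
    (fun y _ => by
      simpa using ((hd y).fun_sub (((hasDerivAt_id y).sub_const x).smul_const _)).hasDerivWithinAt)
    (fun y hy => ?_) (convex_Icc _ _) ⟨le_rfl, by linarith⟩ ⟨by linarith, le_rfl⟩
  · simpa [sub_right_comm, abs_of_nonneg hη, mul_assoc, sq] using hmv
  · refine (convex_univ.norm_image_sub_le_of_norm_hasDerivWithin_le
      (fun z _ => (hd' z).hasDerivWithinAt) (fun z _ => hB z) trivial trivial).trans ?_
    rw [Real.norm_of_nonneg (by linarith [hy.1])]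
    gcongr
    linarith [hy.2]

theorem mul_norm_deriv_le {g g' g'' : ℝ → E} (hd : ∀ x, HasDerivAt g (g' x) x)
    (hd' : ∀ x, HasDerivAt g' (g'' x) x) {B : ℝ} (hB : ∀ x, ‖g'' x‖ ≤ B) (x : ℝ) {η : ℝ}
    (hη : 0 ≤ η) : η * ‖g' x‖ ≤ ‖g (x + η)‖ + ‖g x‖ + B * η ^ 2 := by
  calc η * ‖g' x‖ = ‖g (x + η) - g x - (g (x + η) - g x - η • g' x)‖ := by
        rw [sub_sub_cancel, norm_smul, Real.norm_of_nonneg hη]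
    _ ≤ ‖g (x + η)‖ + ‖g x‖ + B * η ^ 2 := (norm_sub_le _ _).trans <|
        add_le_add (norm_sub_le _ _) (norm_sub_sub_smul_deriv_le hd hd' hB x hη)

/-- Rapid decay in the supremum norm; the weight `1 + x²` is smooth, unlike `1 + |x|`. -/
def RapidDecay (g : ℝ → E) : Prop := ∀ j : ℕ, ∃ C : ℝ, ∀ x : ℝ, (1 + x ^ 2) ^ j * ‖g x‖ ≤ C

theorem RapidDecay.deriv {g g' g'' : ℝ → E} (hg : RapidDecay g)
    (hd : ∀ x, HasDerivAt g (g' x) x) (hd' : ∀ x, HasDerivAt g' (g'' x) x)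
    {B : ℝ} (hB : ∀ x, ‖g'' x‖ ≤ B) : RapidDecay g' := by
  intro j
  obtain ⟨C, hC⟩ := hg (j + j)
  refine ⟨3 ^ (j + j) * C + C + B, fun x => ?_⟩
  set W := (1 + x ^ 2) ^ j with hW
  set η := W⁻¹
  have hWη : W * η = 1 := mul_inv_cancel₀ (by positivity)
  have hη0 : 0 ≤ η := by positivity
  have hη1 : η ≤ 1 := inv_le_one_of_one_le₀ (one_le_pow₀ (by linarith [sq_nonneg x]))
  have hfar : W * W * ‖g (x + η)‖ ≤ 3 ^ (j + j) * C := calc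
    W * W * ‖g (x + η)‖ ≤ (3 * (1 + (x + η) ^ 2)) ^ (j + j) * ‖g (x + η)‖ := by
        rw [hW, ← pow_add]
        gcongr
        nlinarith [sq_nonneg (x + 2 * η)]
    _ ≤ 3 ^ (j + j) * C := by
        rw [mul_pow, mul_assoc]
        exact mul_le_mul_of_nonneg_left (hC _) (by positivity)
  have hnear : W * W * ‖g x‖ ≤ C := by simpa only [hW, pow_add] using hC x
  calc W * ‖g' x‖ = W * η * (W * ‖g' x‖) := by rw [hWη, one_mul]
    _ = W * W * (η * ‖g' x‖) := by ring
    _ ≤ W * W * (‖g (x + η)‖ + ‖g x‖ + B * η ^ 2) := by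
        gcongr
        exact mul_norm_deriv_le hd hd' hB x hη0
    _ = W * W * ‖g (x + η)‖ + W * W * ‖g x‖ + B * (W * η) ^ 2 := by ring
    _ ≤ 3 ^ (j + j) * C + C + B := by
        rw [hWη, one_pow, mul_one]
        gcongr

end Line

theorem IsSmooth.hasDerivAt_iteratedDeriv {f : ℝ → ℂ} (hf : IsSmooth f) (k : ℕ) (x : ℝ) :
    HasDerivAt (iteratedDeriv k f) (iteratedDeriv (k + 1) f x) x := by
  rw [iteratedDeriv_succ]
  exact ((hf.contDiff.differentiable_iteratedDeriv k
    (mod_cast ENat.natCast_lt_top k)) x).hasDerivAt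

theorem IsSmooth.continuous_iteratedDeriv {f : ℝ → ℂ} (hf : IsSmooth f) (k : ℕ) :
    Continuous (iteratedDeriv k f) :=
  hf.contDiff.continuous_iteratedDeriv k (mod_cast le_top)

theorem IsSmooth.integrable_norm_sq {f : ℝ → ℂ} (hf : IsSmooth f) (k : ℕ) :
    Integrable fun x => ‖iteratedDeriv k f x‖ ^ 2 :=
  (memLp_two_iff_integrable_sq_norm (hf.memLp_deriv k).1).1 (hf.memLp_deriv k)

theorem IsSmooth.integrable_weight_mul_norm_sq {f : ℝ → ℂ} (hf : IsSmooth f) (j : ℕ) :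
    Integrable fun x : ℝ => (1 + x ^ 2) ^ j * ‖f x‖ ^ 2 := by
  refine ((memLp_two_iff_integrable_sq_norm (hf.memLp_weight j).1).1 (hf.memLp_weight j)).congr
    (.of_forall fun x => ?_)
  dsimp only
  rw [norm_mul, mul_pow, Complex.norm_real, Real.norm_of_nonneg (by positivity), ← pow_mul,
    mul_comm j, pow_mul, Real.sq_sqrt (by positivity)]

theorem IsSmooth.exists_norm_iteratedDeriv_le {f : ℝ → ℂ} (hf : IsSmooth f) (k : ℕ) :
    ∃ B : ℝ, ∀ x, ‖iteratedDeriv k f x‖ ≤ B :=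
  ⟨_, fun x => Real.le_sqrt_of_sq_le <| norm_sq_le_integral (hf.hasDerivAt_iteratedDeriv k)
    (hf.continuous_iteratedDeriv _) (hf.integrable_norm_sq k) (hf.integrable_norm_sq _) x⟩

theorem abs_mul_one_add_sq_pow_pred_le (m : ℕ) (x : ℝ) :
    |m * (1 + x ^ 2) ^ (m - 1) * (2 * x)| ≤ m * (1 + x ^ 2) ^ m := by
  cases m with
  | zero => simp
  | succ m =>
    have hx : |2 * x| ≤ 1 + x ^ 2 := by
      rw [abs_le]
      constructor <;> nlinarith [sq_nonneg (x + 1), sq_nonneg (x - 1)]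
    rw [abs_mul, abs_of_nonneg (by positivity), Nat.add_sub_cancel, pow_succ (1 + x ^ 2),
      ← mul_assoc]
    gcongr

theorem IsSmooth.rapidDecay {f : ℝ → ℂ} (hf : IsSmooth f) : RapidDecay f := by
  intro j
  have hw (x : ℝ) : HasDerivAt (fun y : ℝ => (1 + y ^ 2) ^ (j + j))
      ((j + j : ℕ) * (1 + x ^ 2) ^ (j + j - 1) * (2 * x)) x := by
    simpa using ((hasDerivAt_pow 2 x).const_add 1).fun_pow (j + j)
  have hd (x : ℝ) : HasDerivAt f (iteratedDeriv 1 f x) x := by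
    simpa using hf.hasDerivAt_iteratedDeriv 0 x
  have hc : Continuous f := hf.contDiff.continuous
  have hw'f : Integrable fun x : ℝ =>
      (j + j : ℕ) * (1 + x ^ 2) ^ (j + j - 1) * (2 * x) * ‖f x‖ ^ 2 := by
    refine ((hf.integrable_weight_mul_norm_sq (j + j)).const_mul ((j + j : ℕ) : ℝ)).mono'
      (by fun_prop) (.of_forall fun x => ?_)
    rw [norm_mul, norm_pow, norm_norm, ← mul_assoc _ (_ ^ (j + j))]
    gcongr
    exact abs_mul_one_add_sq_pow_pred_le (j + j) x
  have hsq (x : ℝ) : ((1 + x ^ 2) ^ (j + j) * ‖f x‖) ^ 2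
      = (1 + x ^ 2) ^ (2 * (j + j)) * ‖f x‖ ^ 2 := by ring
  refine ⟨_, fun x => Real.le_sqrt_of_sq_le <| le_trans (le_of_eq ?_) <|
    mul_norm_sq_le_integral hd hw (hf.continuous_iteratedDeriv 1) (by fun_prop)
      (hf.integrable_weight_mul_norm_sq _) hw'f
      (by simpa only [hsq] using hf.integrable_weight_mul_norm_sq _)
      (hf.integrable_norm_sq 1) x⟩
  ring

theorem IsSmooth.rapidDecay_iteratedDeriv {f : ℝ → ℂ} (hf : IsSmooth f) (k : ℕ) :
    RapidDecay (iteratedDeriv k f) := by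
  induction k with
  | zero => simpa using hf.rapidDecay
  | succ k ih =>
    obtain ⟨B, hB⟩ := hf.exists_norm_iteratedDeriv_le (k + 2)
    exact ih.deriv (hf.hasDerivAt_iteratedDeriv k) (hf.hasDerivAt_iteratedDeriv (k + 1)) hB

theorem IsSmooth.exists_schwartzMap {f : ℝ → ℂ} (hf : IsSmooth f) :
    ∃ F : 𝓢(ℝ, ℂ), (F : ℝ → ℂ) = f := by
  refine ⟨⟨f, hf.contDiff, fun k n => ?_⟩, rfl⟩
  obtain ⟨C, hC⟩ := hf.rapidDecay_iteratedDeriv n k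
  refine ⟨C, fun x => le_trans ?_ (hC x)⟩
  rw [norm_iteratedFDeriv_eq_norm_iteratedDeriv]
  gcongr
  rw [Real.norm_eq_abs, ← sq_abs]
  nlinarith [sq_nonneg (|x| - 1)]

/-! ### Determinacy of moments -/

theorem hasSum_exp_smul {E : Type*} [NormedAddCommGroup E] [NormedSpace ℂ E] (z : ℂ) (v : E) :
    HasSum (fun n : ℕ => (z ^ n / n.factorial) • v) (Complex.exp z • v) := by
  rw [Complex.exp_eq_exp_ℂ]
  exact (NormedSpace.expSeries_div_hasSum_exp z).smul_const v

theorem fourier_eq_zero_of_integral_pow_smul_eq_zero {E : Type*} [NormedAddCommGroup E]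
    [NormedSpace ℂ E] {G : ℝ → E} (hc : Continuous G)
    (hexp : ∀ c : ℝ, Integrable fun v => Real.exp (c * |v|) * ‖G v‖)
    (hmom : ∀ n : ℕ, ∫ v : ℝ, (v : ℂ) ^ n • G v = 0) : FourierTransform.fourier G = 0 := by
  ext w
  rw [Real.fourier_real_eq_integral_exp_smul]
  set c : ℂ := -2 * Real.pi * w * Complex.I with hcdef
  have hbound (v : ℝ) : HasSum (fun n : ℕ => (‖c‖ * |v|) ^ n / n.factorial * ‖G v‖)
      (Real.exp (‖c‖ * |v|) * ‖G v‖) := by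
    rw [Real.exp_eq_exp_ℝ]
    exact (NormedSpace.expSeries_div_hasSum_exp (‖c‖ * |v|)).mul_right _
  have hnorm (n : ℕ) (v : ℝ) :
      ‖((c * v) ^ n / n.factorial) • G v‖ = (‖c‖ * |v|) ^ n / n.factorial * ‖G v‖ := by
    simp [norm_smul]
  have hterm (n : ℕ) : ∫ v : ℝ, ((c * v) ^ n / n.factorial) • G v = 0 := by
    simp only [mul_pow, mul_div_right_comm, mul_smul, integral_smul, hmom, smul_zero]
  have hsum : HasSum (fun n : ℕ => ∫ v : ℝ, ((c * v) ^ n / n.factorial) • G v)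
      (∫ v : ℝ, Complex.exp (c * v) • G v) :=
    hasSum_integral_of_dominated_convergence
      (fun n v => (‖c‖ * |v|) ^ n / n.factorial * ‖G v‖)
      (fun n => by fun_prop) (fun n => .of_forall fun v => (hnorm n v).le)
      (.of_forall fun v => (hbound v).summable)
      (by simpa only [fun v => (hbound v).tsum_eq] using hexp ‖c‖)
      (.of_forall fun v => hasSum_exp_smul (c * v) (G v))
  simp only [hterm] at hsum
  have hphase (v : ℝ) : ((-2 * Real.pi * v * w : ℝ) : ℂ) * Complex.I = c * v := by
    rw [hcdef]
    push_cast
    ring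
  simp only [hphase, Pi.zero_apply]
  exact hsum.unique hasSum_zero

theorem eq_zero_of_integral_pow_smul_eq_zero {E : Type*} [NormedAddCommGroup E]
    [NormedSpace ℂ E] [CompleteSpace E] {G : ℝ → E} (hc : Continuous G)
    (hexp : ∀ c : ℝ, Integrable fun v => Real.exp (c * |v|) * ‖G v‖)
    (hmom : ∀ n : ℕ, ∫ v : ℝ, (v : ℂ) ^ n • G v = 0) : G = 0 := by
  have hF := fourier_eq_zero_of_integral_pow_smul_eq_zero hc hexp hmom
  have hG : Integrable G := by
    have h0 := hexp 0
    simp only [zero_mul, Real.exp_zero, one_mul] at h0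
    exact (integrable_norm_iff hc.aestronglyMeasurable).1 h0
  rw [← hc.fourierInv_fourier_eq hG (by rw [hF]; exact integrable_zero _ _ _), hF]
  ext w
  simp [Real.fourierInv_eq]

/-! ### Families of functions of polynomial growth in the index -/

section PolyBounded

variable {α : Type*} {F G : ℕ → α → ℝ}

/-- The functions `F n` are bounded, uniformly in the argument, by a polynomial in the index `n`. -/
def PolyBounded (F : ℕ → α → ℝ) : Prop :=
  ∃ (C : ℝ) (p : ℕ), 0 ≤ C ∧ ∀ n x, |F n x| ≤ C * ((n : ℝ) + 1) ^ p

theorem PolyBounded.of_abs_le (hG : PolyBounded G) (h : ∀ n x, |F n x| ≤ |G n x|) :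
    PolyBounded F := by
  obtain ⟨C, p, hC, hG⟩ := hG
  exact ⟨C, p, hC, fun n x => (h n x).trans (hG n x)⟩

theorem PolyBounded.add (hF : PolyBounded F) (hG : PolyBounded G) :
    PolyBounded fun n x => F n x + G n x := by
  obtain ⟨C, p, hC, hF⟩ := hF
  obtain ⟨D, q, hD, hG⟩ := hG
  refine ⟨C + D, p + q, by positivity, fun n x => (abs_add_le _ _).trans ?_⟩
  have hn : (1 : ℝ) ≤ n + 1 := by linarith [n.cast_nonneg (α := ℝ)]
  calc |F n x| + |G n x| ≤ C * ((n : ℝ) + 1) ^ p + D * ((n : ℝ) + 1) ^ q :=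
        add_le_add (hF n x) (hG n x)
    _ ≤ C * ((n : ℝ) + 1) ^ (p + q) + D * ((n : ℝ) + 1) ^ (p + q) := by
        gcongr <;> first | exact hn | omega
    _ = (C + D) * ((n : ℝ) + 1) ^ (p + q) := by ring

theorem PolyBounded.mul (hF : PolyBounded F) (hG : PolyBounded G) :
    PolyBounded fun n x => F n x * G n x := by
  obtain ⟨C, p, hC, hF⟩ := hF
  obtain ⟨D, q, hD, hG⟩ := hG
  refine ⟨C * D, p + q, by positivity, fun n x => ?_⟩
  rw [abs_mul, pow_add, mul_mul_mul_comm]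
  gcongr
  exacts [hF n x, hG n x]

theorem PolyBounded.const (c : ℝ) : PolyBounded fun (_ : ℕ) (_ : α) => c :=
  ⟨|c|, 0, abs_nonneg c, fun _ _ => by simp⟩

theorem PolyBounded.sum {ι : Type*} {F : ι → ℕ → α → ℝ} (s : Finset ι)
    (h : ∀ i ∈ s, PolyBounded (F i)) : PolyBounded fun n x => ∑ i ∈ s, F i n x := by
  induction s using Finset.cons_induction with
  | empty => simpa using PolyBounded.const 0
  | cons i s hi ih =>
    rw [Finset.forall_mem_cons] at h
    simpa only [Finset.sum_cons] using h.1.add (ih h.2)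

theorem PolyBounded.reindex (hF : PolyBounded F) {φ : ℕ → ℕ} (hφ : ∀ n, φ n ≤ n + 1) :
    PolyBounded fun n => F (φ n) := by
  obtain ⟨C, p, hC, hF⟩ := hF
  refine ⟨C * 2 ^ p, p, by positivity, fun n x => (hF _ x).trans ?_⟩
  have hφn : (φ n : ℝ) + 1 ≤ 2 * ((n : ℝ) + 1) := by
    have : (φ n : ℝ) ≤ n + 1 := by exact_mod_cast hφ n
    linarith [n.cast_nonneg (α := ℝ)]
  rw [mul_assoc, ← mul_pow]
  gcongr

end PolyBounded

/-! ### Hermite functions -/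

/-- The normalization constant of `ψ_n`. -/
noncomputable def hermiteNorm (n : ℕ) : ℝ :=
  1 / (Real.pi ^ (1 / 4 : ℝ) * (2 : ℝ) ^ ((n : ℝ) / 2) * √(n.factorial : ℝ))

/-- The matrix element `√(n/2)` of the ladder operators between `ψ_{n-1}` and `ψ_n`. As it vanishes
at `n = 0`, the junk value `ψ_{0-1} = ψ_0` never contributes to the ladder relations. -/
noncomputable def ladder (n : ℕ) : ℝ := √((n : ℝ) / 2)

theorem ladder_mul_self (n : ℕ) : ladder n * ladder n = n / 2 :=
  Real.mul_self_sqrt (by positivity)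

theorem ladder_succ_pos (n : ℕ) : 0 < ladder (n + 1) := by
  unfold ladder
  positivity

theorem hermitePoly_succ (n : ℕ) (x : ℝ) :
    hermitePoly (n + 1) x = 2 * x * hermitePoly n x - 2 * n * hermitePoly (n - 1) x := by
  cases n with
  | zero => simp [hermitePoly]
  | succ n => simp [hermitePoly]

theorem hasDerivAt_hermitePoly (n : ℕ) (x : ℝ) :
    HasDerivAt (hermitePoly n) (2 * n * hermitePoly (n - 1) x) x := by
  induction n using Nat.twoStepInduction with
  | zero => simpa [hermitePoly] using hasDerivAt_const x (1 : ℝ)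
  | one => simpa [hermitePoly] using (hasDerivAt_id x).const_mul (2 : ℝ)
  | more n ih₀ ih₁ =>
    have h : HasDerivAt (fun y => 2 * y * hermitePoly (n + 1) y
        - 2 * ((n : ℝ) + 1) * hermitePoly n y) _ x :=
      (((hasDerivAt_id x).const_mul 2).mul ih₁).sub (ih₀.const_mul (2 * ((n : ℝ) + 1)))
    refine h.congr_deriv ?_
    simp only [Nat.add_sub_cancel, id, Nat.reduceSubDiff, hermitePoly_succ n]
    push_cast
    ring

theorem hermiteNorm_pos (n : ℕ) : 0 < hermiteNorm n := by
  unfold hermiteNorm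
  positivity

theorem hermiteNorm_eq_mul_succ (n : ℕ) :
    hermiteNorm n = 2 * ladder (n + 1) * hermiteNorm (n + 1) := by
  have hpow : (2 : ℝ) ^ (((n + 1 : ℕ) : ℝ) / 2) = 2 ^ ((n : ℝ) / 2) * √2 := by
    rw [Real.sqrt_eq_rpow, ← Real.rpow_add (by norm_num)]
    push_cast
    ring_nf
  have hfac : √((n + 1).factorial : ℝ) = √((n + 1 : ℕ) : ℝ) * √(n.factorial : ℝ) := by
    rw [Nat.factorial_succ, Nat.cast_mul, Real.sqrt_mul (by positivity)]
  have hladder : 2 * ladder (n + 1) = √2 * √((n + 1 : ℕ) : ℝ) := by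
    rw [ladder, Real.sqrt_div (by positivity), mul_div_left_comm, Real.div_sqrt, mul_comm]
  rw [hladder, hermiteNorm, hermiteNorm, hpow, hfac]
  field_simp

theorem ladder_succ_mul_hermiteNorm (n : ℕ) :
    ladder (n + 1) * hermiteNorm (n + 1) = hermiteNorm n / 2 := by
  rw [hermiteNorm_eq_mul_succ n]
  ring

theorem ladder_mul_hermiteNorm_pred (n : ℕ) :
    ladder n * hermiteNorm (n - 1) = n * hermiteNorm n := by
  cases n with
  | zero => simp [ladder]
  | succ n =>
    rw [Nat.add_sub_cancel, hermiteNorm_eq_mul_succ n]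
    linear_combination 2 * hermiteNorm (n + 1) * ladder_mul_self (n + 1)

theorem hermiteFun_eq (n : ℕ) (x : ℝ) :
    hermiteFun n x = hermiteNorm n * Real.exp (-x ^ 2 / 2) * hermitePoly n x := rfl

theorem mul_hermiteFun (n : ℕ) (x : ℝ) :
    x * hermiteFun n x =
      ladder (n + 1) * hermiteFun (n + 1) x + ladder n * hermiteFun (n - 1) x := by
  simp only [hermiteFun_eq, hermitePoly_succ]
  linear_combination Real.exp (-x ^ 2 / 2) * (-hermitePoly (n - 1) x * ladder_mul_hermiteNorm_pred n
    - (2 * x * hermitePoly n x - 2 * n * hermitePoly (n - 1) x) * ladder_succ_mul_hermiteNorm n)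

theorem hasDerivAt_exp_neg_sq_div_two (x : ℝ) :
    HasDerivAt (fun y : ℝ => Real.exp (-y ^ 2 / 2)) (-x * Real.exp (-x ^ 2 / 2)) x := by
  refine ((hasDerivAt_pow 2 x).fun_neg.div_const 2).exp.congr_deriv ?_
  simp
  ring

theorem hasDerivAt_hermiteFun (n : ℕ) (x : ℝ) :
    HasDerivAt (hermiteFun n)
      (ladder n * hermiteFun (n - 1) x - ladder (n + 1) * hermiteFun (n + 1) x) x := by
  refine (((hasDerivAt_exp_neg_sq_div_two x).const_mul (hermiteNorm n)).mul
    (hasDerivAt_hermitePoly n x)).congr_deriv ?_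
  have hlow := ladder_mul_hermiteNorm_pred n
  have hmul := mul_hermiteFun n x
  simp only [hermiteFun_eq] at hmul ⊢
  linear_combination -hmul - 2 * Real.exp (-x ^ 2 / 2) * hermitePoly (n - 1) x * hlow

theorem hasDerivAt_deriv_hermiteFun (n : ℕ) (x : ℝ) :
    HasDerivAt (deriv (hermiteFun n)) ((x ^ 2 - (2 * n + 1)) * hermiteFun n x) x := by
  have hderiv : deriv (hermiteFun n) =
      fun y => y * hermiteFun n y - 2 * ladder (n + 1) * hermiteFun (n + 1) y := by
    ext y
    rw [(hasDerivAt_hermiteFun n y).deriv]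
    linear_combination -mul_hermiteFun n y
  rw [hderiv]
  refine (((hasDerivAt_id x).mul (hasDerivAt_hermiteFun n x)).sub
    ((hasDerivAt_hermiteFun (n + 1) x).const_mul (2 * ladder (n + 1)))).congr_deriv ?_
  have hup := mul_hermiteFun (n + 1) x
  have hsq := ladder_mul_self (n + 1)
  simp only [Nat.add_sub_cancel, id, Nat.cast_add, Nat.cast_one] at hup hsq ⊢
  linear_combination -x * mul_hermiteFun n x - 2 * ladder (n + 1) * hup
    - 4 * hermiteFun n x * hsq

/-! ### The harmonic oscillator on the Schwartz space -/

theorem exists_abs_polynomial_mul_gaussian_le (p : Polynomial ℝ) :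
    ∃ C : ℝ, ∀ x : ℝ, |p.eval x * Real.exp (-(x ^ 2 / 2))| ≤ C := by
  induction p using Polynomial.induction_on' with
  | add p q hp hq =>
    obtain ⟨C, hC⟩ := hp
    obtain ⟨D, hD⟩ := hq
    refine ⟨C + D, fun x => ?_⟩
    rw [Polynomial.eval_add, add_mul]
    exact (abs_add_le _ _).trans (add_le_add (hC x) (hD x))
  | monomial n a =>
    have hc : Continuous fun x : ℝ => x ^ n * Real.exp (-(x ^ 2 / 2)) := by fun_prop
    have ht : Filter.Tendsto (fun x : ℝ => x ^ n * Real.exp (-(x ^ 2 / 2)))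
        (Filter.cocompact ℝ) (nhds 0) := by
      rw [tendsto_zero_iff_norm_tendsto_zero]
      refine (tendsto_rpow_abs_mul_exp_neg_mul_sq_cocompact (a := 1 / 2) (by norm_num) n).congr
        fun x => ?_
      rw [norm_mul, norm_pow, Real.norm_eq_abs, Real.norm_eq_abs, Real.abs_exp, Real.rpow_natCast]
      ring_nf
    let F : ZeroAtInftyContinuousMap ℝ ℝ := ⟨⟨_, hc⟩, ht⟩
    refine ⟨|a| * ‖F.toBCF‖, fun x => ?_⟩
    rw [Polynomial.eval_monomial, mul_assoc, abs_mul]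
    exact mul_le_mul_of_nonneg_left (F.toBCF.norm_coe_le_norm x) (abs_nonneg a)

/-- The Gaussian `e^{-x²/2}` as a Schwartz function. -/
noncomputable def gaussianSchwartz : 𝓢(ℝ, ℂ) where
  toFun x := ((Real.exp (-(x ^ 2 / 2)) : ℝ) : ℂ)
  smooth' := Complex.ofRealCLM.contDiff.comp
    (show ContDiff ℝ _ fun x : ℝ => Real.exp (-(x ^ 2 / 2)) by fun_prop)
  decay' k n := by
    obtain ⟨C, hC⟩ := exists_abs_polynomial_mul_gaussian_le
      (Polynomial.X ^ k * (Polynomial.hermite n).map (Int.castRingHom ℝ))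
    refine ⟨C, fun x => le_trans (le_of_eq ?_) (hC x)⟩
    have hreal : ‖iteratedFDeriv ℝ n (fun x : ℝ => ((Real.exp (-(x ^ 2 / 2)) : ℝ) : ℂ)) x‖
        = ‖iteratedFDeriv ℝ n (fun x : ℝ => Real.exp (-(x ^ 2 / 2))) x‖ :=
      Complex.ofRealLI.norm_iteratedFDeriv_comp_left
        (show ContDiffAt ℝ n (fun x : ℝ => Real.exp (-(x ^ 2 / 2))) x by fun_prop) le_rfl
    rw [hreal, norm_iteratedFDeriv_eq_norm_iteratedDeriv, iteratedDeriv_eq_iterate,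
      Polynomial.deriv_gaussian_eq_hermite_mul_gaussian]
    simp only [Polynomial.eval_mul, Polynomial.eval_pow, Polynomial.eval_X, Polynomial.eval_map,
      Real.norm_eq_abs, abs_mul, abs_pow, abs_neg, abs_one, one_pow, one_mul, Polynomial.aeval_def,
      algebraMap_int_eq, mul_assoc]

theorem gaussianSchwartz_apply (x : ℝ) :
    gaussianSchwartz x = ((Real.exp (-(x ^ 2 / 2)) : ℝ) : ℂ) := rfl

/-- Multiplication by the coordinate on the Schwartz space. -/
noncomputable def mulX : 𝓢(ℝ, ℂ) →L[ℝ] 𝓢(ℝ, ℂ) := smulLeftCLM ℂ (fun x : ℝ => x)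

theorem mulX_apply (f : 𝓢(ℝ, ℂ)) (x : ℝ) : mulX f x = (x : ℂ) * f x := by
  rw [mulX, smulLeftCLM_apply_apply Function.HasTemperateGrowth.id', Complex.real_smul]

theorem coe_derivCLM (f : 𝓢(ℝ, ℂ)) : (derivCLM ℝ ℂ f : ℝ → ℂ) = deriv f :=
  funext fun x => derivCLM_apply ℝ f x

/-- The Hermite function `ψ_n` as a complex-valued Schwartz function, obtained from the Gaussian by
applying the raising operator `x - ∂ₓ`. -/
noncomputable def hermiteSchwartz : ℕ → 𝓢(ℝ, ℂ)
  | 0 => hermiteNorm 0 • gaussianSchwartz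
  | n + 1 => (2 * ladder (n + 1))⁻¹ • (mulX (hermiteSchwartz n) - derivCLM ℝ ℂ (hermiteSchwartz n))

theorem hermiteSchwartz_apply (n : ℕ) (x : ℝ) : hermiteSchwartz n x = (hermiteFun n x : ℂ) := by
  induction n generalizing x with
  | zero =>
    simp [hermiteSchwartz, hermiteFun_eq, hermitePoly, gaussianSchwartz_apply, neg_div, mul_comm]
  | succ n ih =>
    have hraise : hermiteFun (n + 1) x =
        (2 * ladder (n + 1))⁻¹ * (x * hermiteFun n x - deriv (hermiteFun n) x) := by
      rw [mul_hermiteFun, (hasDerivAt_hermiteFun n x).deriv]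
      have := (ladder_succ_pos n).ne'
      field_simp
      ring
    have hderiv : deriv (hermiteSchwartz n) x = (deriv (hermiteFun n) x : ℝ) := by
      rw [funext ih, (hasDerivAt_hermiteFun n x).ofReal_comp.deriv,
        (hasDerivAt_hermiteFun n x).deriv]
    rw [hraise, hermiteSchwartz, smul_apply, sub_apply, mulX_apply, coe_derivCLM, hderiv, ih]
    simp only [Complex.real_smul]
    push_cast
    rfl

theorem coe_hermiteSchwartz (n : ℕ) :
    (hermiteSchwartz n : ℝ → ℂ) = fun x => (hermiteFun n x : ℂ) :=
  funext (hermiteSchwartz_apply n)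

theorem contDiff_hermiteFun (n : ℕ) : ContDiff ℝ (⊤ : ℕ∞) (hermiteFun n) := by
  simpa [Function.comp_def, hermiteSchwartz_apply] using
    Complex.reCLM.contDiff.comp ((hermiteSchwartz n).smooth ⊤)

/-- The harmonic oscillator `-∂ₓ² + x²` on the Schwartz space. -/
noncomputable def oscillator (f : 𝓢(ℝ, ℂ)) : 𝓢(ℝ, ℂ) :=
  mulX (mulX f) - derivCLM ℝ ℂ (derivCLM ℝ ℂ f)

theorem oscillator_hermiteSchwartz (n : ℕ) :
    oscillator (hermiteSchwartz n) = (2 * n + 1 : ℝ) • hermiteSchwartz n := by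
  have hderiv : deriv (fun x => (hermiteFun n x : ℂ)) =
      fun x => ((deriv (hermiteFun n) x : ℝ) : ℂ) := funext fun x => by
      rw [(hasDerivAt_hermiteFun n x).ofReal_comp.deriv, (hasDerivAt_hermiteFun n x).deriv]
  ext x
  rw [oscillator, sub_apply, mulX_apply, mulX_apply, coe_derivCLM, coe_derivCLM,
    coe_hermiteSchwartz, hderiv, (hasDerivAt_deriv_hermiteFun n x).ofReal_comp.deriv, smul_apply,
    hermiteSchwartz_apply, Complex.real_smul]
  push_cast
  ring

theorem integrable_schwartz_mul (f g : 𝓢(ℝ, ℂ)) : Integrable (fun x => f x * g x) :=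
  (SchwartzMap.pairing (ContinuousLinearMap.mul ℝ ℂ) f g).integrable

theorem integral_oscillator_mul (f g : 𝓢(ℝ, ℂ)) :
    ∫ x, oscillator f x * g x = ∫ x, f x * oscillator g x := by
  have hparts : ∫ x, derivCLM ℝ ℂ (derivCLM ℝ ℂ f) x * g x
      = ∫ x, f x * derivCLM ℝ ℂ (derivCLM ℝ ℂ g) x := by
    have h₁ := integral_mul_deriv_eq_neg_deriv_mul f (derivCLM ℝ ℂ g)
    have h₂ := integral_mul_deriv_eq_neg_deriv_mul (derivCLM ℝ ℂ f) g
    simp only [← coe_derivCLM] at h₁ h₂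
    rw [h₁, h₂, neg_neg]
  have hmul : ∫ x, mulX (mulX f) x * g x = ∫ x, f x * mulX (mulX g) x := by
    simp only [mulX_apply, mul_assoc, mul_left_comm (f _)]
  simp only [oscillator, sub_apply, sub_mul, mul_sub]
  rw [integral_sub (integrable_schwartz_mul _ _) (integrable_schwartz_mul _ _),
    integral_sub (integrable_schwartz_mul _ _) (integrable_schwartz_mul _ _), hparts, hmul]

/-! ### Orthonormality and polynomial bounds -/

theorem hermiteCoeff_eq_integral (f : ℝ → ℂ) (n : ℕ) :
    hermiteCoeff f n = ∫ x, f x * hermiteSchwartz n x := by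
  simp only [hermiteCoeff, hermiteSchwartz_apply]

theorem hermiteCoeff_oscillator (f : 𝓢(ℝ, ℂ)) (n : ℕ) :
    hermiteCoeff (oscillator f) n = (2 * n + 1) * hermiteCoeff f n := by
  rw [hermiteCoeff_eq_integral, hermiteCoeff_eq_integral, integral_oscillator_mul,
    ← integral_const_mul, oscillator_hermiteSchwartz]
  congr 1 with x
  rw [smul_apply, Complex.real_smul]
  push_cast
  ring

theorem hermiteCoeff_smul (c : ℝ) (f : 𝓢(ℝ, ℂ)) (n : ℕ) :
    hermiteCoeff (⇑(c • f)) n = c * hermiteCoeff f n := by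
  simp only [hermiteCoeff, ← integral_const_mul, smul_apply, Complex.real_smul, mul_assoc]

theorem integral_hermiteFun_mul_of_ne {m n : ℕ} (hmn : m ≠ n) :
    ∫ x, hermiteFun m x * hermiteFun n x = 0 := by
  have heigen := hermiteCoeff_oscillator (hermiteSchwartz m) n
  rw [oscillator_hermiteSchwartz, hermiteCoeff_smul] at heigen
  have hne : (m : ℂ) - n ≠ 0 := sub_ne_zero.2 (Nat.cast_injective.ne hmn)
  have hzero : hermiteCoeff (hermiteSchwartz m) n = 0 := by
    refine (mul_eq_zero.1 (?_ : ((m : ℂ) - n) * _ = 0)).resolve_left hne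
    push_cast at heigen
    linear_combination heigen / 2
  simp only [hermiteCoeff, hermiteSchwartz_apply, ← Complex.ofReal_mul] at hzero
  rw [integral_complex_ofReal] at hzero
  exact_mod_cast hzero

theorem integrable_hermiteFun_mul (m n : ℕ) :
    Integrable (fun x => hermiteFun m x * hermiteFun n x) := by
  simpa [hermiteSchwartz_apply] using
    (integrable_schwartz_mul (hermiteSchwartz m) (hermiteSchwartz n)).re

theorem integral_hermiteFun_zero_mul_self : ∫ x, hermiteFun 0 x * hermiteFun 0 x = 1 := by
  have hnorm : hermiteNorm 0 * hermiteNorm 0 = (√Real.pi)⁻¹ := by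
    have hpi : √Real.pi = Real.pi ^ (1 / 4 : ℝ) * Real.pi ^ (1 / 4 : ℝ) := by
      rw [Real.sqrt_eq_rpow, ← Real.rpow_add Real.pi_pos]
      norm_num
    simp [hermiteNorm, hpi]
  have hsq (x : ℝ) :
      hermiteFun 0 x * hermiteFun 0 x = (√Real.pi)⁻¹ * Real.exp (-1 * x ^ 2) := by
    rw [← hnorm, show -1 * x ^ 2 = -x ^ 2 / 2 + -x ^ 2 / 2 by ring, Real.exp_add]
    simp only [hermiteFun_eq, hermitePoly]
    ring
  simp only [hsq]
  rw [integral_const_mul, integral_gaussian, div_one]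
  exact inv_mul_cancel₀ (by positivity)

theorem integral_mul_hermiteFun_mul (m n : ℕ) :
    ∫ x, x * hermiteFun m x * hermiteFun n x
      = ladder (m + 1) * (∫ x, hermiteFun (m + 1) x * hermiteFun n x)
        + ladder m * ∫ x, hermiteFun (m - 1) x * hermiteFun n x := by
  simp only [mul_hermiteFun m, add_mul, mul_assoc]
  rw [integral_add ((integrable_hermiteFun_mul _ _).const_mul _)
    ((integrable_hermiteFun_mul _ _).const_mul _), integral_const_mul, integral_const_mul]

theorem integral_hermiteFun_mul_self (n : ℕ) : ∫ x, hermiteFun n x * hermiteFun n x = 1 := by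
  induction n with
  | zero => exact integral_hermiteFun_zero_mul_self
  | succ n ih =>
    have hup := integral_mul_hermiteFun_mul n (n + 1)
    have hdown := integral_mul_hermiteFun_mul (n + 1) n
    rw [integral_hermiteFun_mul_of_ne (show n - 1 ≠ n + 1 by omega)] at hup
    rw [integral_hermiteFun_mul_of_ne (show n + 1 + 1 ≠ n by omega), Nat.add_sub_cancel, ih]
      at hdown
    have hsymm : ∫ x, x * hermiteFun n x * hermiteFun (n + 1) x
        = ∫ x, x * hermiteFun (n + 1) x * hermiteFun n x := by
      simp only [mul_right_comm]
    refine mul_left_cancel₀ (ladder_succ_pos n).ne' ?_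
    linear_combination hdown - hup + hsymm

theorem sq_mul_hermiteFun_sub (a b : ℝ) (m n : ℕ) (x : ℝ) :
    (a * hermiteFun m x - b * hermiteFun n x) ^ 2
      = a ^ 2 * (hermiteFun m x * hermiteFun m x) - 2 * a * b * (hermiteFun m x * hermiteFun n x)
        + b ^ 2 * (hermiteFun n x * hermiteFun n x) := by
  ring

theorem integrable_sq_mul_hermiteFun_sub (a b : ℝ) (m n : ℕ) :
    Integrable fun x => (a * hermiteFun m x - b * hermiteFun n x) ^ 2 := by
  simp only [sq_mul_hermiteFun_sub]
  exact (((integrable_hermiteFun_mul m m).const_mul _).sub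
    ((integrable_hermiteFun_mul m n).const_mul _)).add
    ((integrable_hermiteFun_mul n n).const_mul _)

theorem integral_sq_mul_hermiteFun_sub (a b : ℝ) {m n : ℕ} (hmn : m ≠ n) :
    ∫ x, (a * hermiteFun m x - b * hermiteFun n x) ^ 2 = a ^ 2 + b ^ 2 := by
  have hm := (integrable_hermiteFun_mul m m).const_mul (a ^ 2)
  have hmn' := (integrable_hermiteFun_mul m n).const_mul (2 * a * b)
  have hn := (integrable_hermiteFun_mul n n).const_mul (b ^ 2)
  have hsub : Integrable fun x => a ^ 2 * (hermiteFun m x * hermiteFun m x)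
      - 2 * a * b * (hermiteFun m x * hermiteFun n x) := hm.sub hmn'
  simp only [sq_mul_hermiteFun_sub]
  rw [integral_add hsub hn, integral_sub hm hmn']
  simp only [integral_const_mul, integral_hermiteFun_mul_self, integral_hermiteFun_mul_of_ne hmn]
  ring

theorem abs_hermiteFun_le (n : ℕ) (x : ℝ) : |hermiteFun n x| ≤ 2 * ((n : ℝ) + 1) := by
  have hint : Integrable fun y => hermiteFun n y ^ 2 := by
    simpa only [sq] using integrable_hermiteFun_mul n n
  have hint' := integrable_sq_mul_hermiteFun_sub (ladder n) (ladder (n + 1)) (n - 1) (n + 1)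
  have hbound := norm_sq_le_integral (hasDerivAt_hermiteFun n)
    (((contDiff_hermiteFun _).continuous.const_mul _).sub
      ((contDiff_hermiteFun _).continuous.const_mul _))
    (by simpa only [Real.norm_eq_abs, sq_abs] using hint)
    (by simpa only [Real.norm_eq_abs, sq_abs] using hint') x
  simp only [Real.norm_eq_abs, sq_abs] at hbound
  rw [integral_add hint hint', integral_sq_mul_hermiteFun_sub _ _ (by omega)] at hbound
  simp only [sq, integral_hermiteFun_mul_self, ladder_mul_self] at hbound
  refine abs_le_of_sq_le_sq ?_ (by positivity)
  push_cast at hbound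
  nlinarith [n.cast_nonneg (α := ℝ)]

theorem polyBounded_ladder {α : Type*} : PolyBounded fun n (_ : α) => ladder n := by
  refine ⟨1, 1, zero_le_one, fun n _ => ?_⟩
  simp only [ladder, abs_of_nonneg (Real.sqrt_nonneg _), one_mul, pow_one]
  rw [Real.sqrt_le_left (by positivity)]
  nlinarith [n.cast_nonneg (α := ℝ)]

theorem polyBounded_ladder_mul_add {α : Type*} {F : ℕ → α → ℝ} (hF : PolyBounded F) (c : ℝ) :
    PolyBounded fun n x => ladder n * F (n - 1) x + c * (ladder (n + 1) * F (n + 1) x) :=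
  (polyBounded_ladder.mul (hF.reindex fun n => by omega)).add
    ((PolyBounded.const c).mul ((polyBounded_ladder.mul hF).reindex fun _ => le_rfl))

theorem polyBounded_pow_mul_hermiteFun (j : ℕ) :
    PolyBounded fun n x => x ^ j * hermiteFun n x := by
  induction j with
  | zero => exact ⟨2, 1, zero_le_two, by simpa using abs_hermiteFun_le⟩
  | succ j ih =>
    convert polyBounded_ladder_mul_add ih 1 using 3 with n x
    rw [pow_succ, mul_assoc, mul_hermiteFun]
    ring

theorem iteratedDeriv_succ_hermiteFun (k n : ℕ) (x : ℝ) :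
    iteratedDeriv (k + 1) (hermiteFun n) x = ladder n * iteratedDeriv k (hermiteFun (n - 1)) x
      - ladder (n + 1) * iteratedDeriv k (hermiteFun (n + 1)) x := by
  have hsmooth (m : ℕ) : ContDiffAt ℝ k (hermiteFun m) x :=
    ((contDiff_hermiteFun m).of_le (mod_cast le_top)).contDiffAt
  rw [iteratedDeriv_succ', funext fun y => (hasDerivAt_hermiteFun n y).deriv,
    iteratedDeriv_fun_sub (contDiffAt_const.mul (hsmooth _)) (contDiffAt_const.mul (hsmooth _)),
    iteratedDeriv_const_mul_field, iteratedDeriv_const_mul_field]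

theorem polyBounded_pow_mul_iteratedDeriv_hermiteFun (j k : ℕ) :
    PolyBounded fun n x => x ^ j * iteratedDeriv k (hermiteFun n) x := by
  induction k with
  | zero => simpa only [iteratedDeriv_zero] using polyBounded_pow_mul_hermiteFun j
  | succ k ih =>
    convert polyBounded_ladder_mul_add ih (-1) using 3 with n x
    rw [iteratedDeriv_succ_hermiteFun]
    ring

theorem polyBounded_eval_mul_iteratedDeriv_hermiteFun (P : Polynomial ℝ) (k : ℕ) :
    PolyBounded fun n x => P.eval x * iteratedDeriv k (hermiteFun n) x := by
  simp only [Polynomial.eval_eq_sum_range, Finset.sum_mul, mul_assoc]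
  exact PolyBounded.sum _ fun i _ =>
    (PolyBounded.const _).mul (polyBounded_pow_mul_iteratedDeriv_hermiteFun i k)

theorem exists_weight_mul_iteratedDeriv_hermiteFun_le (q K : ℕ) :
    ∃ (C : ℝ) (p : ℕ), 0 ≤ C ∧ ∀ (n : ℕ) (x : ℝ), ∀ k ≤ K,
      (1 + x ^ 2) ^ q * |iteratedDeriv k (hermiteFun n) x| ≤ C * ((n : ℝ) + 1) ^ p := by
  have hsum := PolyBounded.sum (Finset.range (K + 1)) fun k _ =>
    (polyBounded_eval_mul_iteratedDeriv_hermiteFun ((1 + Polynomial.X ^ 2) ^ q) k).of_abs_le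
      (F := fun n x => (1 + x ^ 2) ^ q * |iteratedDeriv k (hermiteFun n) x|)
      fun n x => by simp [abs_mul]
  obtain ⟨C, p, hC, hCp⟩ := hsum
  refine ⟨C, p, hC, fun n x k hk => ?_⟩
  refine le_trans ?_ ((le_abs_self _).trans (hCp n x))
  exact Finset.single_le_sum
    (f := fun k => (1 + x ^ 2) ^ q * |iteratedDeriv k (hermiteFun n) x|)
    (fun _ _ => by positivity) (Finset.mem_range.2 (by omega))

/-! ### Decay of the Hermite coefficients -/

theorem norm_hermiteCoeff_le {f : ℝ → ℂ} (hf : Integrable f) (n : ℕ) :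
    ‖hermiteCoeff f n‖ ≤ (2 * ∫ x, ‖f x‖) * ((n : ℝ) + 1) := by
  rw [mul_right_comm, mul_comm, ← integral_mul_const]
  refine norm_integral_le_of_norm_le (hf.norm.mul_const _) (.of_forall fun x => ?_)
  rw [norm_mul, Complex.norm_real]
  gcongr
  exact abs_hermiteFun_le n x

theorem exists_norm_hermiteCoeff_mul_pow_le (k : ℕ) (f : 𝓢(ℝ, ℂ)) :
    ∃ C : ℝ, ∀ n : ℕ, ‖hermiteCoeff f n‖ * ((n : ℝ) + 1) ^ k ≤ C * ((n : ℝ) + 1) := by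
  induction k generalizing f with
  | zero =>
    exact ⟨2 * ∫ x, ‖f x‖, fun n => by simpa using norm_hermiteCoeff_le f.integrable n⟩
  | succ k ih =>
    obtain ⟨C, hC⟩ := ih (oscillator f)
    refine ⟨C, fun n => le_trans ?_ (hC n)⟩
    have heigen : ‖hermiteCoeff (oscillator f) n‖ = (2 * n + 1) * ‖hermiteCoeff f n‖ := by
      rw [hermiteCoeff_oscillator, norm_mul]
      congr 1
      exact_mod_cast Complex.norm_natCast (2 * n + 1)
    calc ‖hermiteCoeff f n‖ * ((n : ℝ) + 1) ^ (k + 1)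
        = ((n : ℝ) + 1) * ‖hermiteCoeff f n‖ * ((n : ℝ) + 1) ^ k := by ring
      _ ≤ (2 * n + 1) * ‖hermiteCoeff f n‖ * ((n : ℝ) + 1) ^ k := by
          gcongr
          linarith [n.cast_nonneg (α := ℝ)]
      _ = ‖hermiteCoeff (oscillator f) n‖ * ((n : ℝ) + 1) ^ k := by rw [heigen]

theorem summable_norm_hermiteCoeff_mul_pow (f : 𝓢(ℝ, ℂ)) (k : ℕ) :
    Summable fun n : ℕ => ‖hermiteCoeff f n‖ * ((n : ℝ) + 1) ^ k := by
  obtain ⟨C, hC⟩ := exists_norm_hermiteCoeff_mul_pow_le (k + 3) f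
  have hsq : Summable fun n : ℕ => C * (1 / ((n : ℝ) + 1) ^ 2) := by
    have := (summable_nat_add_iff 1).2 (Real.summable_one_div_nat_pow (p := 2).2 (by norm_num))
    push_cast at this
    exact this.mul_left C
  refine hsq.of_nonneg_of_le (fun n => by positivity) fun n => ?_
  rw [mul_one_div, le_div_iff₀ (by positivity)]
  refine le_of_mul_le_mul_right ?_ (by positivity : (0 : ℝ) < (n : ℝ) + 1)
  calc _ = ‖hermiteCoeff f n‖ * ((n : ℝ) + 1) ^ (k + 3) := by ring
    _ ≤ _ := hC n

theorem norm_exp_neg_I_mul (θ t : ℝ) : ‖Complex.exp (-Complex.I * θ * t)‖ = 1 := by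
  rw [show -Complex.I * θ * t = ((-θ * t : ℝ) : ℂ) * Complex.I by push_cast; ring]
  exact Complex.norm_exp_ofReal_mul_I _

theorem norm_evolutionTerm_le (f : ℝ → ℂ) (t x : ℝ) (n : ℕ) :
    ‖evolutionTerm f t x n‖ ≤ 2 * (‖hermiteCoeff f n‖ * ((n : ℝ) + 1) ^ 1) := by
  have hphase := norm_exp_neg_I_mul (2 * n + 1) t
  push_cast at hphase
  rw [evolutionTerm, norm_mul, norm_mul, hphase, Complex.norm_real, mul_one, pow_one,
    mul_left_comm]
  gcongr
  exact abs_hermiteFun_le n x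

theorem summable_evolutionTerm (f : 𝓢(ℝ, ℂ)) (t x : ℝ) : Summable (evolutionTerm f t x) :=
  .of_norm_bounded ((summable_norm_hermiteCoeff_mul_pow f 1).mul_left 2)
    (norm_evolutionTerm_le f t x)

/-! ### Completeness of the Hermite functions -/

theorem mulX_hermiteSchwartz (m : ℕ) :
    mulX (hermiteSchwartz m) =
      ladder (m + 1) • hermiteSchwartz (m + 1) + ladder m • hermiteSchwartz (m - 1) := by
  ext x
  simp only [mulX_apply, add_apply, smul_apply, hermiteSchwartz_apply, Complex.real_smul]
  exact_mod_cast mul_hermiteFun m x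

theorem mulX_pow_apply (n : ℕ) (f : 𝓢(ℝ, ℂ)) (x : ℝ) : (mulX ^ n) f x = (x : ℂ) ^ n * f x := by
  induction n generalizing f with
  | zero => simp
  | succ n ih => rw [pow_succ, mul_apply_eq_comp, ih, mulX_apply, pow_succ, mul_assoc]

theorem integral_mul_mulX_pow_hermiteSchwartz_eq_zero {g : ℝ → ℂ}
    (hint : ∀ S : 𝓢(ℝ, ℂ), Integrable fun x => g x * S x) (h0 : ∀ n, hermiteCoeff g n = 0)
    (n m : ℕ) : ∫ x, g x * (mulX ^ n) (hermiteSchwartz m) x = 0 := by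
  induction n generalizing m with
  | zero => simpa [hermiteCoeff_eq_integral] using h0 m
  | succ n ih =>
    have hladder (x : ℝ) : g x * (mulX ^ (n + 1)) (hermiteSchwartz m) x
        = (ladder (m + 1) : ℂ) * (g x * (mulX ^ n) (hermiteSchwartz (m + 1)) x)
          + (ladder m : ℂ) * (g x * (mulX ^ n) (hermiteSchwartz (m - 1)) x) := by
      rw [pow_succ, mul_apply_eq_comp, mulX_hermiteSchwartz, map_add, map_smul, map_smul,
        add_apply, smul_apply, smul_apply, Complex.real_smul, Complex.real_smul]
      ring
    simp only [hladder]
    rw [integral_add ((hint _).const_mul _) ((hint _).const_mul _), integral_const_mul,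
      integral_const_mul, ih, ih, mul_zero, mul_zero, add_zero]

theorem hermiteFun_zero (x : ℝ) : hermiteFun 0 x = hermiteNorm 0 * Real.exp (-x ^ 2 / 2) := by
  rw [hermiteFun_eq, hermitePoly, mul_one]

theorem exp_mul_abs_mul_hermiteFun_zero_le (c x : ℝ) :
    Real.exp (c * |x|) * hermiteFun 0 x
      ≤ hermiteNorm 0 * Real.exp (c ^ 2) * Real.exp (-(1 / 4) * x ^ 2) := by
  rw [hermiteFun_zero, mul_left_comm, mul_assoc, ← Real.exp_add, ← Real.exp_add]
  refine mul_le_mul_of_nonneg_left (Real.exp_le_exp.2 ?_) (hermiteNorm_pos 0).le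
  nlinarith [sq_nonneg (c - |x| / 2), sq_abs x]

theorem integrable_exp_mul_abs_mul_hermiteFun_zero (c : ℝ) :
    Integrable fun x : ℝ => Real.exp (c * |x|) * hermiteFun 0 x := by
  have hcont := (contDiff_hermiteFun 0).continuous
  refine ((integrable_exp_neg_mul_sq (b := 1 / 4) (by norm_num)).const_mul
    (hermiteNorm 0 * Real.exp (c ^ 2))).mono' (by fun_prop) (.of_forall fun x => ?_)
  have hpos := hermiteNorm_pos 0
  rw [Real.norm_of_nonneg (by rw [hermiteFun_zero]; positivity)]
  exact exp_mul_abs_mul_hermiteFun_zero_le c x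

theorem integrable_mul_schwartz {g : ℝ → ℂ} (hc : Continuous g) {B : ℝ} (hB : ∀ x, ‖g x‖ ≤ B)
    (S : 𝓢(ℝ, ℂ)) : Integrable fun x => g x * S x :=
  S.integrable.bdd_mul hc.aestronglyMeasurable (.of_forall hB)

theorem eq_zero_of_hermiteCoeff_eq_zero {g : ℝ → ℂ} (hc : Continuous g) {B : ℝ}
    (hB : ∀ x, ‖g x‖ ≤ B) (h0 : ∀ n, hermiteCoeff g n = 0) : g = 0 := by
  have hpos (x : ℝ) : 0 < hermiteFun 0 x := by
    rw [hermiteFun_zero]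
    exact mul_pos (hermiteNorm_pos 0) (Real.exp_pos _)
  have hnorm (x : ℝ) : ‖hermiteSchwartz 0 x‖ = hermiteFun 0 x := by
    rw [hermiteSchwartz_apply, Complex.norm_real, Real.norm_of_nonneg (hpos x).le]
  have hzero : (fun x => g x * hermiteSchwartz 0 x) = 0 := by
    refine eq_zero_of_integral_pow_smul_eq_zero (hc.mul (hermiteSchwartz 0).continuous)
      (fun c => ?_) fun n => ?_
    · have hcont : Continuous fun x => ‖g x‖ := hc.norm
      refine ((integrable_exp_mul_abs_mul_hermiteFun_zero c).bdd_mul hcont.aestronglyMeasurable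
        (.of_forall fun x => (norm_norm (g x)).trans_le (hB x))).congr (.of_forall fun x => ?_)
      simp only [norm_mul, hnorm]
      ring
    · simpa only [mulX_pow_apply, smul_eq_mul, mul_left_comm] using
        integral_mul_mulX_pow_hermiteSchwartz_eq_zero (integrable_mul_schwartz hc hB) h0 n 0
  ext x
  refine (mul_eq_zero.1 (congrFun hzero x)).resolve_right fun h => ?_
  rw [← norm_eq_zero, hnorm] at h
  exact (hpos x).ne' h

theorem hermiteCoeff_hermiteFun (m n : ℕ) :
    hermiteCoeff (fun x => (hermiteFun m x : ℂ)) n = if m = n then 1 else 0 := by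
  simp only [hermiteCoeff, ← Complex.ofReal_mul]
  rw [integral_complex_ofReal]
  split_ifs with h
  · rw [h, integral_hermiteFun_mul_self, Complex.ofReal_one]
  · rw [integral_hermiteFun_mul_of_ne h, Complex.ofReal_zero]

section HermiteSeries

variable {c : ℕ → ℂ}

theorem norm_mul_hermiteFun_le (c : ℕ → ℂ) (n : ℕ) (x : ℝ) :
    ‖c n * (hermiteFun n x : ℂ)‖ ≤ 2 * (‖c n‖ * ((n : ℝ) + 1)) := by
  rw [norm_mul, Complex.norm_real, mul_left_comm]
  gcongr
  exact abs_hermiteFun_le n x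

theorem continuous_tsum_hermiteFun (hc : Summable fun n => ‖c n‖ * ((n : ℝ) + 1)) :
    Continuous fun x => ∑' n, c n * (hermiteFun n x : ℂ) :=
  continuous_tsum (fun n => continuous_const.mul
    (Complex.continuous_ofReal.comp (contDiff_hermiteFun n).continuous)) (hc.mul_left 2)
    (norm_mul_hermiteFun_le c)

theorem norm_tsum_hermiteFun_le (hc : Summable fun n => ‖c n‖ * ((n : ℝ) + 1)) (x : ℝ) :
    ‖∑' n, c n * (hermiteFun n x : ℂ)‖ ≤ ∑' n, 2 * (‖c n‖ * ((n : ℝ) + 1)) :=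
  tsum_of_norm_bounded (hc.mul_left 2).hasSum (norm_mul_hermiteFun_le c · x)

theorem hermiteCoeff_tsum_hermiteFun (hc : Summable fun n => ‖c n‖ * ((n : ℝ) + 1)) (n : ℕ) :
    hermiteCoeff (fun x => ∑' m, c m * (hermiteFun m x : ℂ)) n = c n := by
  have hint (m : ℕ) : Integrable fun x => c m * (hermiteFun m x : ℂ) * hermiteSchwartz n x := by
    simpa only [mul_assoc, hermiteSchwartz_apply] using
      (integrable_schwartz_mul (hermiteSchwartz m) (hermiteSchwartz n)).const_mul (c m)
  have hsum := hasSum_integral_of_summable_integral_norm hint (by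
    refine ((hc.mul_left 2).mul_right (∫ x, ‖hermiteSchwartz n x‖)).of_nonneg_of_le
      (fun m => by positivity) fun m => ?_
    rw [← integral_const_mul]
    refine integral_mono (hint m).norm ((hermiteSchwartz n).integrable.norm.const_mul _)
      fun x => ?_
    simp only [norm_mul (c m * _)]
    gcongr
    exact norm_mul_hermiteFun_le c m x)
  have hcoeff (m : ℕ) : ∫ x, c m * (hermiteFun m x : ℂ) * hermiteSchwartz n x
      = if m = n then c n else 0 := by
    simp only [mul_assoc, hermiteSchwartz_apply]
    rw [integral_const_mul, ← hermiteCoeff, hermiteCoeff_hermiteFun]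
    split_ifs with h <;> simp [h]
  simp only [hcoeff, tsum_mul_right] at hsum
  rw [hermiteCoeff_eq_integral]
  exact hsum.unique (hasSum_ite_eq n (c n))

end HermiteSeries

theorem hasSum_hermiteCoeff_mul_hermiteFun (f : 𝓢(ℝ, ℂ)) (x : ℝ) :
    HasSum (fun n => hermiteCoeff f n * (hermiteFun n x : ℂ)) (f x) := by
  have hc : Summable fun n => ‖hermiteCoeff f n‖ * ((n : ℝ) + 1) := by
    simpa using summable_norm_hermiteCoeff_mul_pow f 1
  set S : ℝ → ℂ := fun x => ∑' n, hermiteCoeff f n * (hermiteFun n x : ℂ)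
  have hS : Continuous S := continuous_tsum_hermiteFun hc
  obtain ⟨B, -, hB⟩ := f.decay 0 0
  have hf (x : ℝ) : ‖f x‖ ≤ B := by simpa using hB x
  have hzero : (fun x => f x - S x) = 0 := by
    refine eq_zero_of_hermiteCoeff_eq_zero (f.continuous.sub hS)
      (fun x => (norm_sub_le _ _).trans (add_le_add (hf x) (norm_tsum_hermiteFun_le hc x)))
      fun n => ?_
    rw [hermiteCoeff_eq_integral]
    simp only [sub_mul]
    rw [integral_sub (integrable_schwartz_mul _ _)
      (integrable_mul_schwartz hS (norm_tsum_hermiteFun_le hc) _), ← hermiteCoeff_eq_integral,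
      ← hermiteCoeff_eq_integral, hermiteCoeff_tsum_hermiteFun hc, sub_self]
  have hfS : f x = S x := sub_eq_zero.1 (congrFun hzero x)
  rw [hfS]
  exact (Summable.of_norm_bounded (hc.mul_left 2) (norm_mul_hermiteFun_le _ · x)).hasSum

/-! ### The mesh -/

/-- The grid point `k h`. -/
noncomputable def pt (h : ℝ) (k : ℤ) : Grid h := ⟨k * h, k, by simp⟩

theorem coe_pt (h : ℝ) (k : ℤ) : ((pt h k : Grid h) : ℝ) = k * h := rfl

theorem pt_surjective (h : ℝ) : Function.Surjective (pt h) := by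
  rintro ⟨_, k, rfl⟩
  exact ⟨k, Subtype.ext (by simp [coe_pt])⟩

theorem pt_injective {h : ℝ} (h0 : 0 < h) : Function.Injective (pt h) := by
  intro k l hkl
  have : (k : ℝ) * h = l * h := congrArg Subtype.val hkl
  exact_mod_cast mul_right_cancel₀ h0.ne' this

theorem pt_add_step (h : ℝ) (k : ℤ) : pt h k + Grid.step h = pt h (k + 1) :=
  Subtype.ext (by simp [coe_pt, Grid.step, add_mul])

theorem coe_add_step {h : ℝ} (a : Grid h) : ((a + Grid.step h : Grid h) : ℝ) = a + h := rfl

theorem coe_sub_step {h : ℝ} (a : Grid h) : ((a - Grid.step h : Grid h) : ℝ) = a - h := rfl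

theorem InA.abs_mul_le_one {h : ℝ} (h0 : 0 < h) {a : Grid h} (ha : InA h a) : |a * h| ≤ 1 := by
  rw [abs_le, ← div_le_iff₀ h0, ← le_div_iff₀ h0, neg_div]
  exact ha

/-- The mesh size `h = M^{-1/2}`, which is `h = √2 N^{-1/2}` for `N = 2M`. -/
structure IsMesh (M : ℕ) (h : ℝ) : Prop where
  pos : 0 < h
  sq_mul : h ^ 2 * M = 1

/-- The `j`-th point of `A_h`, counted from `-1/h`; the indices `j ≤ 2M` exhaust `A_h`. -/
noncomputable def node (M : ℕ) (h : ℝ) (j : ℕ) : Grid h := pt h (j - M)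

theorem coe_node (M : ℕ) (h : ℝ) (j : ℕ) : ((node M h j : Grid h) : ℝ) = (j - M) * h := by
  rw [node, coe_pt]
  push_cast
  rfl

theorem node_add_step (M : ℕ) (h : ℝ) (j : ℕ) : node M h j + Grid.step h = node M h (j + 1) := by
  rw [node, pt_add_step, node]
  congr 1
  push_cast
  ring

/-- The bilinear form `h ∑_{a ∈ A_h} u(a) v(a)`. -/
noncomputable def gridPairing (M : ℕ) (h : ℝ) (u v : Grid h → ℂ) : ℂ :=
  h * ∑ j ∈ Finset.range (2 * M + 1), u (node M h j) * v (node M h j)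

namespace IsMesh

variable {M : ℕ} {h : ℝ}

theorem inv_sq (hm : IsMesh M h) : 1 / h ^ 2 = M := by
  have := hm.pos
  rw [div_eq_iff (by positivity), mul_comm, hm.sq_mul]

theorem two_div_sq (hm : IsMesh M h) : 2 / h ^ 2 = (2 * M : ℕ) := by
  rw [← mul_one_div, hm.inv_sq]
  push_cast
  rfl

theorem inA_pt_iff (hm : IsMesh M h) (k : ℤ) : InA h (pt h k) ↔ -(M : ℤ) ≤ k ∧ k ≤ M := by
  have hinv : 1 / h = M * h := by
    rw [div_eq_iff hm.pos.ne']
    linear_combination -hm.sq_mul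
  rw [InA, coe_pt, hinv, Set.mem_Icc, ← neg_mul, mul_le_mul_iff_left₀ hm.pos,
    mul_le_mul_iff_left₀ hm.pos]
  norm_cast

theorem inA_node (hm : IsMesh M h) {j : ℕ} (hj : j ≤ 2 * M) : InA h (node M h j) :=
  (hm.inA_pt_iff _).2 (by omega)

theorem exists_eq_node (hm : IsMesh M h) {a : Grid h} (ha : InA h a) :
    ∃ j ≤ 2 * M, a = node M h j := by
  obtain ⟨k, rfl⟩ := pt_surjective h a
  have hk := (hm.inA_pt_iff k).1 ha
  exact ⟨(k + M).toNat, by omega, congrArg (pt h) (by omega)⟩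

end IsMesh

/-! ### The binomial weight -/

theorem rho_of_notMem {h : ℝ} {a : Grid h} (ha : ¬ InA h a) : rho h a = 0 := if_neg ha

namespace IsMesh

variable {M : ℕ} {h : ℝ}

theorem rho_node (hm : IsMesh M h) {j : ℕ} (hj : j ≤ 2 * M) :
    rho h (node M h j) = 1 / h * (((2 * M).choose j : ℝ) / 2 ^ (2 * M)) := by
  have h0 := hm.pos
  have hdiv : ((node M h j : Grid h) : ℝ) / h = j - M := by
    rw [coe_node, mul_div_cancel_right₀ _ h0.ne']
  have hleft : 1 + 1 / h ^ 2 + ((node M h j : Grid h) : ℝ) / h = (j : ℝ) + 1 := by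
    rw [hm.inv_sq, hdiv]
    ring
  have hright : 1 + 1 / h ^ 2 - ((node M h j : Grid h) : ℝ) / h = ((2 * M - j : ℕ) : ℝ) + 1 := by
    rw [hm.inv_sq, hdiv, Nat.cast_sub hj]
    push_cast
    ring
  rw [rho, if_pos (hm.inA_node hj), hleft, hright, hm.two_div_sq, Real.rpow_natCast,
    add_comm (1 : ℝ), Real.Gamma_nat_eq_factorial, Real.Gamma_nat_eq_factorial,
    Real.Gamma_nat_eq_factorial, Nat.cast_choose ℝ hj]
  field_simp

theorem rho_nonneg (hm : IsMesh M h) (a : Grid h) : 0 ≤ rho h a := by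
  by_cases ha : InA h a
  · obtain ⟨j, hj, rfl⟩ := hm.exists_eq_node ha
    rw [hm.rho_node hj]
    have := hm.pos
    positivity
  · rw [rho_of_notMem ha]

theorem sum_rho (hm : IsMesh M h) :
    h * ∑ j ∈ Finset.range (2 * M + 1), rho h (node M h j) = 1 := by
  have h0 := hm.pos
  rw [Finset.sum_congr rfl fun j hj => hm.rho_node (Finset.mem_range_succ_iff.1 hj),
    ← Finset.mul_sum, ← Finset.sum_div, ← Nat.cast_sum, Nat.sum_range_choose]
  push_cast
  field_simp

theorem rho_balance_node (hm : IsMesh M h) {j : ℕ} (hj : j < 2 * M) :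
    (1 + node M h j * h + h ^ 2) * rho h (node M h (j + 1))
      = (1 - node M h j * h) * rho h (node M h j) := by
  have hchoose : ((2 * M).choose (j + 1) : ℝ) * (j + 1) = (2 * M).choose j * (2 * M - j) := by
    have hcast : ((2 * M - j : ℕ) : ℝ) = 2 * M - j := by
      rw [Nat.cast_sub hj.le]
      push_cast
      rfl
    rw [← hcast]
    exact_mod_cast Nat.choose_succ_right_eq (2 * M) j
  rw [hm.rho_node hj.le, hm.rho_node hj, coe_node]
  linear_combination (h ^ 2 * (1 / h * (1 / 2 ^ (2 * M)))) * hchoose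
    + (1 / h * (1 / 2 ^ (2 * M))) * (((2 * M).choose j : ℝ) - (2 * M).choose (j + 1)) * hm.sq_mul

theorem rho_balance (hm : IsMesh M h) (a : Grid h) :
    (1 + a * h + h ^ 2) * rho h (a + Grid.step h) = (1 - a * h) * rho h a := by
  obtain ⟨k, rfl⟩ := pt_surjective h a
  have hout {l : ℤ} (hl : l < -M ∨ M < l) : rho h (pt h l) = 0 :=
    rho_of_notMem (mt (hm.inA_pt_iff l).1 (by omega))
  rw [pt_add_step]
  obtain hk | rfl | ⟨hk, hk'⟩ | rfl | hk :
      k < -M - 1 ∨ k = -M - 1 ∨ (-M ≤ k ∧ k < M) ∨ k = M ∨ M < k := by omega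
  · rw [hout (by omega), hout (by omega), mul_zero, mul_zero]
  · rw [hout (l := -M - 1) (by omega), coe_pt]
    push_cast
    linear_combination -rho h (pt h (-M - 1 + 1)) * hm.sq_mul
  · obtain ⟨j, rfl⟩ : ∃ j : ℕ, k = j - M := ⟨(k + M).toNat, by omega⟩
    have hj := hm.rho_balance_node (j := j) (by omega)
    rwa [← node_add_step, node, pt_add_step] at hj
  · rw [hout (l := M + 1) (by omega), coe_pt]
    push_cast
    linear_combination rho h (pt h M) * hm.sq_mul
  · rw [hout (by omega), hout (by omega), mul_zero, mul_zero]

end IsMesh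

/-! ### The Kravchuk oscillator -/

theorem kravchukPoly_add_two (h : ℝ) (n : ℕ) (x : ℝ) :
    kravchukPoly h (n + 2) x = 2 * x * kravchukPoly h (n + 1) x
      - 2 * ((n : ℝ) + 1) * (1 - h ^ 2 * ((n : ℝ) / 2)) * kravchukPoly h n x := rfl

theorem kravchukPoly_difference (h a : ℝ) (n : ℕ) :
    (1 - a * h) * kravchukPoly h n (a + h) + (1 + a * h) * kravchukPoly h n (a - h)
        = (2 - 2 * n * h ^ 2) * kravchukPoly h n a ∧
      (1 - a * h) * kravchukPoly h n (a + h) - (1 + a * h) * kravchukPoly h n (a - h)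
        = 2 * h * (a * kravchukPoly h n a - kravchukPoly h (n + 1) a) := by
  induction n using Nat.twoStepInduction with
  | zero => simp only [kravchukPoly]; constructor <;> push_cast <;> ring
  | one => simp only [kravchukPoly]; constructor <;> push_cast <;> ring
  | more n ih₀ ih₁ =>
    obtain ⟨hsum₀, hdiff₀⟩ := ih₀
    obtain ⟨hsum₁, hdiff₁⟩ := ih₁
    simp only [kravchukPoly_add_two h n, kravchukPoly_add_two h (n + 1)] at hdiff₁ ⊢
    set c := 2 * ((n : ℝ) + 1) * (1 - h ^ 2 * ((n : ℝ) / 2))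
    push_cast at *
    constructor
    · linear_combination 2 * a * hsum₁ + 2 * h * hdiff₁ - c * hsum₀
    · linear_combination 2 * a * hdiff₁ + 2 * h * hsum₁ - c * hdiff₀

/-- The hopping amplitude of `H_h` between `a` and `a + h`. -/
noncomputable def hopping (h a : ℝ) : ℝ := 1 / h ^ 2 * √((1 + a * h + h ^ 2) * (1 - a * h))

section Oscillator

variable {h : ℝ}

theorem kravchukOscillator_of_mem {a : Grid h} (ha : InA h a) (u : Grid h → ℂ) :
    kravchukOscillator h u a = -(hopping h a : ℂ) * u (a + Grid.step h)
      - (hopping h (a - h) : ℂ) * u (a - Grid.step h) + ((1 + 2 / h ^ 2 : ℝ) : ℂ) * u a := by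
  rw [kravchukOscillator, if_pos ha, hopping, hopping]
  congr 6
  ring_nf

theorem kravchukOscillator_of_notMem {a : Grid h} (ha : ¬ InA h a) (u : Grid h → ℂ) :
    kravchukOscillator h u a = 0 := if_neg ha

theorem kravchukOscillator_const_mul (c : ℂ) (u : Grid h → ℂ) (a : Grid h) :
    kravchukOscillator h (fun b => c * u b) a = c * kravchukOscillator h u a := by
  unfold kravchukOscillator
  split_ifs <;> ring

theorem kravchukOscillator_sum {ι : Type*} (s : Finset ι) (u : ι → Grid h → ℂ) (a : Grid h) :
    kravchukOscillator h (fun b => ∑ i ∈ s, u i b) a = ∑ i ∈ s, kravchukOscillator h (u i) a := by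
  unfold kravchukOscillator
  split_ifs
  · simp only [Finset.sum_add_distrib, Finset.sum_sub_distrib, Finset.mul_sum]
  · simp

end Oscillator

/-- The Kravchuk function without its normalization constant. -/
noncomputable def rawKravchukFun (n : ℕ) (h : ℝ) (a : Grid h) : ℂ :=
  ((kravchukPoly h n a * √(rho h a) : ℝ) : ℂ)

theorem coe_kravchukFun (n : ℕ) (h : ℝ) (a : Grid h) :
    (kravchukFun n h a : ℂ) = alpha n h * rawKravchukFun n h a := by
  rw [kravchukFun, rawKravchukFun, mul_assoc, Complex.ofReal_mul]

namespace IsMesh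

variable {M : ℕ} {h : ℝ}

theorem hopping_mul_sqrt_rho_add_step (hm : IsMesh M h) {a : Grid h} (ha : InA h a) :
    hopping h a * √(rho h (a + Grid.step h)) = 1 / h ^ 2 * ((1 - a * h) * √(rho h a)) := by
  obtain ⟨hlow, hup⟩ := abs_le.1 (ha.abs_mul_le_one hm.pos)
  have hsq : (1 + a * h + h ^ 2) * (1 - a * h) * rho h (a + Grid.step h)
      = (1 - a * h) ^ 2 * rho h a := by
    linear_combination (1 - a * h) * hm.rho_balance a
  rw [hopping, mul_assoc, ← Real.sqrt_mul (mul_nonneg (by nlinarith) (by linarith)), hsq,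
    Real.sqrt_mul (sq_nonneg _), Real.sqrt_sq (by linarith)]

theorem hopping_mul_sqrt_rho_sub_step (hm : IsMesh M h) {a : Grid h} (ha : InA h a) :
    hopping h (a - h) * √(rho h (a - Grid.step h)) = 1 / h ^ 2 * ((1 + a * h) * √(rho h a)) := by
  obtain ⟨hlow, hup⟩ := abs_le.1 (ha.abs_mul_le_one hm.pos)
  have hbalance := hm.rho_balance (a - Grid.step h)
  rw [sub_add_cancel, coe_sub_step] at hbalance
  have hsq : (1 + (a - h) * h + h ^ 2) * (1 - (a - h) * h) * rho h (a - Grid.step h)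
      = (1 + a * h) ^ 2 * rho h a := by
    linear_combination -(1 + a * h) * hbalance
  rw [hopping, mul_assoc, ← Real.sqrt_mul (mul_nonneg (by nlinarith) (by nlinarith)), hsq,
    Real.sqrt_mul (sq_nonneg _), Real.sqrt_sq (by linarith)]

theorem kravchukOscillator_rawKravchukFun (hm : IsMesh M h) (n : ℕ) (a : Grid h) :
    kravchukOscillator h (rawKravchukFun n h) a = (2 * n + 1) * rawKravchukFun n h a := by
  by_cases ha : InA h a
  · rw [kravchukOscillator_of_mem ha]
    simp only [rawKravchukFun, coe_add_step, coe_sub_step]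
    norm_cast
    push_cast
    have hinv : 1 / h ^ 2 * h ^ 2 = 1 := one_div_mul_cancel (pow_ne_zero 2 hm.pos.ne')
    linear_combination
      -kravchukPoly h n (a + h) * hm.hopping_mul_sqrt_rho_add_step ha
      - kravchukPoly h n (a - h) * hm.hopping_mul_sqrt_rho_sub_step ha
      - 1 / h ^ 2 * √(rho h a) * (kravchukPoly_difference h a n).1
      + 2 * n * kravchukPoly h n a * √(rho h a) * hinv
  · simp [kravchukOscillator_of_notMem ha, rawKravchukFun, rho_of_notMem ha]

theorem kravchukOscillator_kravchukFun (hm : IsMesh M h) (n : ℕ) (a : Grid h) :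
    kravchukOscillator h (fun b => (kravchukFun n h b : ℂ)) a
      = (2 * n + 1) * (kravchukFun n h a : ℂ) := by
  simp only [coe_kravchukFun]
  rw [kravchukOscillator_const_mul, hm.kravchukOscillator_rawKravchukFun, mul_left_comm]

theorem solvesDiscreteSchrodinger (hm : IsMesh M h) (f : ℝ → ℂ) (nmax : ℕ) :
    SolvesDiscreteSchrodinger h (discreteEvolution f nmax h) := by
  intro t a
  have hderiv : HasDerivAt (fun τ : ℝ => discreteEvolution f nmax h τ a)
      (∑ n ∈ Finset.range (nmax + 1), kravchukCoeff f n h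
        * (Complex.exp (-Complex.I * (2 * n + 1) * t) * (-Complex.I * (2 * n + 1)))
        * (kravchukFun n h a : ℂ)) t := by
    refine HasDerivAt.fun_sum fun n _ => ?_
    have hphase : HasDerivAt (fun τ : ℝ => -Complex.I * (2 * n + 1) * (τ : ℂ))
        (-Complex.I * (2 * n + 1)) t := by
      simpa using (Complex.ofRealCLM.hasDerivAt (x := t)).const_mul (-Complex.I * (2 * n + 1))
    exact (hphase.cexp.const_mul _).mul_const _
  refine hderiv.congr_deriv ?_
  have hsum : discreteEvolution f nmax h t = fun b => ∑ n ∈ Finset.range (nmax + 1),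
      (kravchukCoeff f n h * Complex.exp (-Complex.I * (2 * n + 1) * t))
        * (kravchukFun n h b : ℂ) := rfl
  rw [hsum, kravchukOscillator_sum, Finset.mul_sum]
  refine Finset.sum_congr rfl fun n _ => ?_
  rw [kravchukOscillator_const_mul, hm.kravchukOscillator_kravchukFun]
  ring

theorem gridPairing_kravchukOscillator (hm : IsMesh M h) (u v : Grid h → ℂ) :
    gridPairing M h (kravchukOscillator h u) v = gridPairing M h u (kravchukOscillator h v) := by
  -- Discrete Green identity: the difference telescopes into the Wronskian `W`, which vanishes at
  -- both ends because the hopping amplitudes out of `A_h` are zero.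
  set W : ℕ → ℂ := fun j => (hopping h (node M h j - h) : ℂ)
    * (v (node M h j) * u (node M h j - Grid.step h)
      - u (node M h j) * v (node M h j - Grid.step h)) with hW
  have hfirst : W 0 = 0 := by
    have : 1 + ((node M h 0 : Grid h) - h) * h + h ^ 2 = 0 := by
      rw [coe_node]
      push_cast
      linear_combination -hm.sq_mul
    simp [hW, hopping, this]
  have hlast : W (2 * M + 1) = 0 := by
    have : 1 - ((node M h (2 * M + 1) : Grid h) - h) * h = 0 := by
      rw [coe_node]
      push_cast
      linear_combination -hm.sq_mul
    simp [hW, hopping, this]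
  have hgreen (j : ℕ) (hj : j ∈ Finset.range (2 * M + 1)) :
      kravchukOscillator h u (node M h j) * v (node M h j)
        - u (node M h j) * kravchukOscillator h v (node M h j) = W (j + 1) - W j := by
    have hA := hm.inA_node (Finset.mem_range_succ_iff.1 hj)
    rw [kravchukOscillator_of_mem hA, kravchukOscillator_of_mem hA]
    simp only [hW, ← node_add_step, add_sub_cancel_right, coe_add_step]
    ring
  rw [gridPairing, gridPairing, ← sub_eq_zero, ← mul_sub, ← Finset.sum_sub_distrib,
    Finset.sum_congr rfl hgreen, Finset.sum_range_sub, hfirst, hlast, sub_self, mul_zero]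

end IsMesh

/-! ### Orthonormality of the Kravchuk functions -/

namespace IsMesh

variable {M : ℕ} {h : ℝ}

theorem gridPairing_rawKravchukFun_of_ne (hm : IsMesh M h) {m n : ℕ} (hmn : m ≠ n) :
    gridPairing M h (rawKravchukFun m h) (rawKravchukFun n h) = 0 := by
  have hsymm := hm.gridPairing_kravchukOscillator (rawKravchukFun m h) (rawKravchukFun n h)
  simp only [gridPairing, hm.kravchukOscillator_rawKravchukFun, mul_assoc (2 * (m : ℂ) + 1),
    mul_left_comm _ (2 * (n : ℂ) + 1), ← Finset.mul_sum] at hsymm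
  have hne : (m : ℂ) - n ≠ 0 := sub_ne_zero.2 (Nat.cast_injective.ne hmn)
  refine (mul_eq_zero.1 (?_ : ((m : ℂ) - n) * _ = 0)).resolve_left hne
  rw [gridPairing]
  linear_combination hsymm / 2

theorem gridPairing_rawKravchukFun_zero (hm : IsMesh M h) :
    gridPairing M h (rawKravchukFun 0 h) (rawKravchukFun 0 h) = 1 := by
  simp only [gridPairing, rawKravchukFun, kravchukPoly, one_mul, ← Complex.ofReal_mul,
    Real.mul_self_sqrt (hm.rho_nonneg _)]
  exact_mod_cast hm.sum_rho

theorem gridPairing_two_mul_rawKravchukFun_succ (n : ℕ) (v : Grid h → ℂ) :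
    gridPairing M h (fun a => 2 * (a : ℂ) * rawKravchukFun (n + 1) h a) v
      = gridPairing M h (rawKravchukFun (n + 2) h) v
        + (2 * ((n : ℝ) + 1) * (1 - h ^ 2 * (n / 2)) : ℝ)
          * gridPairing M h (rawKravchukFun n h) v := by
  simp only [gridPairing, Finset.mul_sum, ← Finset.sum_add_distrib]
  refine Finset.sum_congr rfl fun j _ => ?_
  simp only [rawKravchukFun, kravchukPoly_add_two]
  push_cast
  ring

theorem gridPairing_rawKravchukFun_succ_self (hm : IsMesh M h) (n : ℕ) :
    gridPairing M h (rawKravchukFun (n + 1) h) (rawKravchukFun (n + 1) h)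
      = (h ^ 2 * (n + 1) * (2 * M - n))
        * gridPairing M h (rawKravchukFun n h) (rawKravchukFun n h) := by
  have hup : gridPairing M h (fun a => 2 * (a : ℂ) * rawKravchukFun n h a)
      (rawKravchukFun (n + 1) h)
        = gridPairing M h (rawKravchukFun (n + 1) h) (rawKravchukFun (n + 1) h) := by
    cases n with
    | zero => simp [gridPairing, rawKravchukFun, kravchukPoly]
    | succ n =>
      rw [gridPairing_two_mul_rawKravchukFun_succ,
        hm.gridPairing_rawKravchukFun_of_ne (m := n) (by omega), mul_zero, add_zero]
  have hdown := gridPairing_two_mul_rawKravchukFun_succ (M := M) n (rawKravchukFun n h)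
  rw [hm.gridPairing_rawKravchukFun_of_ne (by omega), zero_add] at hdown
  have hsymm : gridPairing M h (fun a => 2 * (a : ℂ) * rawKravchukFun n h a)
      (rawKravchukFun (n + 1) h) = gridPairing M h
        (fun a => 2 * (a : ℂ) * rawKravchukFun (n + 1) h a) (rawKravchukFun n h) := by
    simp only [gridPairing, mul_assoc, mul_comm (rawKravchukFun n h _)]
  have hsq : (h : ℂ) ^ 2 * M = 1 := by exact_mod_cast hm.sq_mul
  rw [← hup, hsymm, hdown]
  push_cast
  linear_combination (-2 * ((n : ℂ) + 1)
    * gridPairing M h (rawKravchukFun n h) (rawKravchukFun n h)) * hsq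

theorem gridPairing_rawKravchukFun_self (hm : IsMesh M h) {n : ℕ} (hn : n ≤ 2 * M) :
    gridPairing M h (rawKravchukFun n h) (rawKravchukFun n h) * (2 * M - n).factorial
      = (h ^ n) ^ 2 * n.factorial * (2 * M).factorial := by
  induction n with
  | zero => simp [hm.gridPairing_rawKravchukFun_zero]
  | succ n ih =>
    have hfac : ((2 * M - n).factorial : ℂ) = (2 * M - n) * (2 * M - (n + 1)).factorial := by
      rw [show 2 * M - n = (2 * M - (n + 1)) + 1 by omega, Nat.factorial_succ, Nat.cast_mul,
        show 2 * M - (n + 1) + 1 = 2 * M - n by omega, Nat.cast_sub (by omega)]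
      push_cast
      ring
    have ih := ih (by omega)
    rw [hfac] at ih
    rw [hm.gridPairing_rawKravchukFun_succ_self, Nat.factorial_succ]
    push_cast
    linear_combination ((h : ℂ) ^ 2 * (n + 1)) * ih

theorem alpha_sq (hm : IsMesh M h) {n : ℕ} (hn : n ≤ 2 * M) :
    alpha n h ^ 2 * ((h ^ n) ^ 2 * n.factorial * (2 * M).factorial)
      = ((2 * M - n).factorial : ℝ) := by
  have h0 := hm.pos
  have harg : 1 + 2 / h ^ 2 - (n : ℝ) = ((2 * M - n : ℕ) : ℝ) + 1 := by
    rw [hm.two_div_sq, Nat.cast_sub hn]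
    ring
  rw [alpha, harg, hm.two_div_sq, add_comm (1 : ℝ), Real.Gamma_nat_eq_factorial,
    Real.Gamma_nat_eq_factorial, mul_pow, Real.sq_sqrt (by positivity), div_pow, mul_pow,
    Real.sq_sqrt (by positivity)]
  field_simp

theorem gridPairing_kravchukFun (hm : IsMesh M h) {m n : ℕ} (hn : n ≤ 2 * M) :
    gridPairing M h (fun a => (kravchukFun m h a : ℂ)) (fun a => (kravchukFun n h a : ℂ))
      = if m = n then 1 else 0 := by
  have hraw : gridPairing M h (fun a => (kravchukFun m h a : ℂ)) (fun a => (kravchukFun n h a : ℂ))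
      = alpha m h * alpha n h * gridPairing M h (rawKravchukFun m h) (rawKravchukFun n h) := by
    simp only [gridPairing, coe_kravchukFun, Finset.mul_sum]
    exact Finset.sum_congr rfl fun j _ => by ring
  rw [hraw]
  split_ifs with hmn
  · subst hmn
    have hnorm := hm.gridPairing_rawKravchukFun_self hn
    have halpha : (alpha m h : ℂ) ^ 2 * ((h ^ m) ^ 2 * m.factorial * (2 * M).factorial)
        = ((2 * M - m).factorial : ℂ) := by exact_mod_cast hm.alpha_sq hn
    have hfac : ((2 * M - m).factorial : ℂ) ≠ 0 := by exact_mod_cast Nat.factorial_ne_zero _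
    refine mul_right_cancel₀ hfac ?_
    linear_combination (alpha m h : ℂ) ^ 2 * hnorm + halpha
  · rw [hm.gridPairing_rawKravchukFun_of_ne hmn, mul_zero]

end IsMesh

/-- The vector of the values of `√h u` on `A_h`, so that `u ↦ toVec M h u` is an isometry from
`ℓ²(A_h)` to a Euclidean space. -/
noncomputable def toVec (M : ℕ) (h : ℝ) (u : Grid h → ℂ) : EuclideanSpace ℂ (Fin (2 * M + 1)) :=
  WithLp.toLp 2 fun j => (√h : ℂ) * u (node M h j)

namespace IsMesh

variable {M : ℕ} {h : ℝ}

theorem inner_toVec (hm : IsMesh M h) (u : Grid h → ℝ) (v : Grid h → ℂ) :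
    inner ℂ (toVec M h fun a => (u a : ℂ)) (toVec M h v)
      = gridPairing M h v fun a => (u a : ℂ) := by
  have hsqrt : (√h : ℂ) * √h = h := by
    rw [← Complex.ofReal_mul, Real.mul_self_sqrt hm.pos.le]
  rw [PiLp.inner_apply, gridPairing, Finset.sum_range, Finset.mul_sum]
  refine Finset.sum_congr rfl fun j _ => ?_
  simp only [toVec, RCLike.inner_apply, map_mul, Complex.conj_ofReal]
  linear_combination v (node M h j) * (u (node M h j) : ℂ) * hsqrt

theorem norm_sq_toVec (hm : IsMesh M h) (v : Grid h → ℂ) :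
    ‖toVec M h v‖ ^ 2 = h * ∑ j ∈ Finset.range (2 * M + 1), ‖v (node M h j)‖ ^ 2 := by
  rw [EuclideanSpace.norm_sq_eq, Finset.sum_range, Finset.mul_sum]
  refine Finset.sum_congr rfl fun j _ => ?_
  simp only [toVec, norm_mul, mul_pow, Complex.norm_real, Real.norm_eq_abs, sq_abs,
    Real.sq_sqrt hm.pos.le]

theorem orthonormal_toVec (hm : IsMesh M h) : Orthonormal ℂ fun n : Fin (2 * M + 1) =>
    toVec M h fun a => (kravchukFun n h a : ℂ) := by
  rw [orthonormal_iff_ite]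
  intro m n
  rw [hm.inner_toVec, hm.gridPairing_kravchukFun (by omega)]
  simp only [Fin.ext_iff, eq_comm]

/-- The Kravchuk functions `φ_{0,h}, …, φ_{N,h}` as an orthonormal basis of `ℓ²(A_h)`. -/
noncomputable def kravchukBasis (hm : IsMesh M h) :
    OrthonormalBasis (Fin (2 * M + 1)) ℂ (EuclideanSpace ℂ (Fin (2 * M + 1))) :=
  (basisOfOrthonormalOfCardEqFinrank hm.orthonormal_toVec (by simp)).toOrthonormalBasis (by
    simpa using hm.orthonormal_toVec)

theorem kravchukBasis_apply (hm : IsMesh M h) (n : Fin (2 * M + 1)) :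
    hm.kravchukBasis n = toVec M h fun a => (kravchukFun n h a : ℂ) := by
  simp [kravchukBasis]

end IsMesh

/-! ### Truncated evolution of an approximate eigenvector -/

theorem norm_le_of_forall_norm_inner_le {𝕜 E ι : Type*} [RCLike 𝕜] [NormedAddCommGroup E]
    [InnerProductSpace 𝕜 E] [Fintype ι] (b : OrthonormalBasis ι 𝕜 E) {x y : E}
    (hxy : ∀ i, ‖inner 𝕜 (b i) x‖ ≤ ‖inner 𝕜 (b i) y‖) : ‖x‖ ≤ ‖y‖ := by
  refine le_of_sq_le_sq ?_ (norm_nonneg y)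
  rw [← b.sum_sq_norm_inner_right x, ← b.sum_sq_norm_inner_right y]
  gcongr with i
  exact hxy i

theorem two_le_norm_two_mul_sub {m n : ℕ} (hmn : n ≠ m) : 2 ≤ ‖2 * (n : ℂ) - 2 * m‖ := by
  have hint : 2 * (n : ℂ) - 2 * m = ((2 * ((n : ℤ) - m) : ℤ) : ℂ) := by push_cast; ring
  rw [hint, Complex.norm_intCast]
  exact_mod_cast show 2 ≤ |2 * ((n : ℤ) - m)| by rw [le_abs]; omega

theorem norm_phase_sub_le {e : ℕ → ℂ} (he : ∀ n, ‖e n‖ = 1) (nmax m n : ℕ) :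
    ‖e m - if n ≤ nmax then e n else 0‖ ≤ 2 := by
  refine (norm_sub_le _ _).trans ?_
  split_ifs
  · rw [he, he, one_add_one_eq_two]
  · rw [he, norm_zero, add_zero]
    exact one_le_two

section GridPairing

variable {M : ℕ} {h : ℝ}

theorem gridPairing_sub (u₁ u₂ v : Grid h → ℂ) :
    gridPairing M h (fun a => u₁ a - u₂ a) v = gridPairing M h u₁ v - gridPairing M h u₂ v := by
  simp only [gridPairing, sub_mul, Finset.sum_sub_distrib, mul_sub]

theorem gridPairing_const_mul (c : ℂ) (u v : Grid h → ℂ) :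
    gridPairing M h (fun a => c * u a) v = c * gridPairing M h u v := by
  simp only [gridPairing, mul_assoc, ← Finset.mul_sum]
  exact mul_left_comm _ _ _

theorem gridPairing_sum {ι : Type*} (s : Finset ι) (u : ι → Grid h → ℂ) (v : Grid h → ℂ) :
    gridPairing M h (fun a => ∑ i ∈ s, u i a) v = ∑ i ∈ s, gridPairing M h (u i) v := by
  simp only [gridPairing, Finset.sum_mul, Finset.mul_sum]
  exact Finset.sum_comm

end GridPairing

/-- The error `e_m u - ∑_{n ≤ nmax} ⟨u, φ_{n,h}⟩ e_n φ_{n,h}` made by evolving `u` as if it were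
the `m`-th eigenvector, where `e_n` is the phase of the `n`-th mode. -/
noncomputable def truncationError (M : ℕ) (h : ℝ) (e : ℕ → ℂ) (nmax m : ℕ) (u : Grid h → ℂ)
    (a : Grid h) : ℂ :=
  e m * u a - ∑ n ∈ Finset.range (nmax + 1),
    gridPairing M h u (fun b => (kravchukFun n h b : ℂ)) * e n * (kravchukFun n h a : ℂ)

namespace IsMesh

variable {M : ℕ} {h : ℝ}

theorem inner_kravchukBasis (hm : IsMesh M h) (n : Fin (2 * M + 1)) (u : Grid h → ℂ) :
    inner ℂ (hm.kravchukBasis n) (toVec M h u)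
      = gridPairing M h u fun a => (kravchukFun n h a : ℂ) := by
  rw [hm.kravchukBasis_apply, hm.inner_toVec]

theorem gridPairing_truncationError (hm : IsMesh M h) (e : ℕ → ℂ) (nmax m : ℕ) (u : Grid h → ℂ)
    {n : ℕ} (hn : n ≤ 2 * M) :
    gridPairing M h (truncationError M h e nmax m u) (fun a => (kravchukFun n h a : ℂ))
      = (e m - if n ≤ nmax then e n else 0)
        * gridPairing M h u fun a => (kravchukFun n h a : ℂ) := by
  unfold truncationError
  rw [gridPairing_sub, gridPairing_const_mul, gridPairing_sum]
  simp only [gridPairing_const_mul, hm.gridPairing_kravchukFun hn, mul_ite, mul_one, mul_zero,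
    Finset.sum_ite_eq', Finset.mem_range, Nat.lt_succ_iff]
  split_ifs <;> ring

theorem gridPairing_kravchukOscillator_sub (hm : IsMesh M h) (m n : ℕ) (u : Grid h → ℂ) :
    gridPairing M h (fun a => kravchukOscillator h u a - (2 * m + 1) * u a)
        (fun a => (kravchukFun n h a : ℂ))
      = (2 * n - 2 * m) * gridPairing M h u fun a => (kravchukFun n h a : ℂ) := by
  have hsymm : gridPairing M h (kravchukOscillator h u) (fun a => (kravchukFun n h a : ℂ))
      = (2 * n + 1) * gridPairing M h u fun a => (kravchukFun n h a : ℂ) := by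
    rw [hm.gridPairing_kravchukOscillator]
    simp only [gridPairing, hm.kravchukOscillator_kravchukFun, mul_left_comm _ (2 * (n : ℂ) + 1),
      ← Finset.mul_sum]
  rw [gridPairing_sub, gridPairing_const_mul, hsymm]
  ring

theorem norm_toVec_truncationError_le (hm : IsMesh M h) {e : ℕ → ℂ} (he : ∀ n, ‖e n‖ = 1)
    (nmax m : ℕ) (u : Grid h → ℂ) :
    ‖toVec M h (truncationError M h e nmax m u)‖ ≤ 2 * ‖toVec M h u‖ := by
  have hbound : ‖toVec M h (truncationError M h e nmax m u)‖ ≤ ‖(2 : ℂ) • toVec M h u‖ := by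
    refine norm_le_of_forall_norm_inner_le hm.kravchukBasis fun n => ?_
    rw [inner_smul_right, hm.inner_kravchukBasis, hm.inner_kravchukBasis,
      hm.gridPairing_truncationError _ _ _ _ (by omega), norm_mul, norm_mul, Complex.norm_two]
    gcongr
    exact norm_phase_sub_le he _ _ _
  rwa [norm_smul, Complex.norm_two] at hbound

theorem norm_toVec_truncationError_le_residual (hm : IsMesh M h) {e : ℕ → ℂ}
    (he : ∀ n, ‖e n‖ = 1) {nmax m : ℕ} (hmn : m ≤ nmax) (u : Grid h → ℂ) :
    ‖toVec M h (truncationError M h e nmax m u)‖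
      ≤ ‖toVec M h fun a => kravchukOscillator h u a - (2 * m + 1) * u a‖ := by
  refine norm_le_of_forall_norm_inner_le hm.kravchukBasis fun n => ?_
  rw [hm.inner_kravchukBasis, hm.inner_kravchukBasis,
    hm.gridPairing_truncationError _ _ _ _ (by omega), hm.gridPairing_kravchukOscillator_sub,
    norm_mul, norm_mul]
  gcongr
  obtain hnm | hnm := eq_or_ne (n : ℕ) m
  · rw [hnm, if_pos hmn, sub_self, norm_zero]
    exact norm_nonneg _
  · exact (norm_phase_sub_le he _ _ _).trans (two_le_norm_two_mul_sub hnm)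

end IsMesh

/-! ### Consistency of the Kravchuk oscillator with the harmonic oscillator -/

section SymmetricDifference

variable {g g₁ g₂ g₃ g₄ : ℝ → ℝ} {a h B s : ℝ}

theorem abs_le_mul_pow_of_abs_deriv_le (hg : ∀ s, HasDerivAt g (g₁ s) s) (h0 : g 0 = 0)
    (hB : 0 ≤ B) {n : ℕ} (hg₁ : ∀ s, 0 ≤ s → s ≤ h → |g₁ s| ≤ B * s ^ n) (hs : 0 ≤ s)
    (hsh : s ≤ h) : |g s| ≤ B * s ^ (n + 1) := by
  have hmvt := (convex_Icc 0 s).norm_image_sub_le_of_norm_hasDerivWithin_le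
    (C := B * s ^ n) (fun y _ => (hg y).hasDerivWithinAt)
    (fun y hy => (hg₁ y hy.1 (hy.2.trans hsh)).trans (by gcongr; exacts [hy.1, hy.2]))
    (Set.left_mem_Icc.2 hs) (Set.right_mem_Icc.2 hs)
  rwa [h0, sub_zero, sub_zero, Real.norm_eq_abs, Real.norm_of_nonneg hs, mul_assoc,
    ← pow_succ] at hmvt

theorem abs_reflect_sub_le (hg : ∀ x, HasDerivAt g (g₁ x) x)
    (hB : ∀ x, |x - a| ≤ h → |g₁ x| ≤ B) (hs : 0 ≤ s) (hsh : s ≤ h) :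
    |g (a + s) - g (a - s)| ≤ 2 * B * s := by
  have hmvt := (convex_Icc (a - s) (a + s)).norm_image_sub_le_of_norm_hasDerivWithin_le
    (C := B) (fun y _ => (hg y).hasDerivWithinAt)
    (fun y hy => hB y (abs_le.2 ⟨by linarith [hy.1], by linarith [hy.2]⟩))
    (Set.left_mem_Icc.2 (by linarith)) (Set.right_mem_Icc.2 (by linarith))
  rw [show a + s - (a - s) = 2 * s by ring, Real.norm_of_nonneg (mul_nonneg zero_le_two hs)] at hmvt
  exact hmvt.trans_eq (by ring)

theorem abs_reflect_add_sub_le (hg : ∀ x, HasDerivAt g (g₁ x) x)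
    (hg₁ : ∀ x, HasDerivAt g₁ (g₂ x) x) (hB : ∀ x, |x - a| ≤ h → |g₂ x| ≤ B) (hs : 0 ≤ s)
    (hsh : s ≤ h) : |g (a + s) + g (a - s) - 2 * g a| ≤ 2 * B * s ^ 2 := by
  have hB0 : 0 ≤ B := (abs_nonneg _).trans (hB a (by simpa using hs.trans hsh))
  refine abs_le_mul_pow_of_abs_deriv_le (g := fun s => g (a + s) + g (a - s) - 2 * g a) (n := 1)
    (fun s => (((hg _).comp_const_add a s).add ((hg _).comp_const_sub a s)).sub_const _)
    (by simp only [add_zero, sub_zero]; ring) (by positivity) (fun r hr hrh => ?_) hs hsh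
  rw [← sub_eq_add_neg, pow_one]
  exact abs_reflect_sub_le hg₁ hB hr hrh

theorem abs_reflect_sub_sub_le (hg : ∀ x, HasDerivAt g (g₁ x) x)
    (hg₁ : ∀ x, HasDerivAt g₁ (g₂ x) x) (hg₂ : ∀ x, HasDerivAt g₂ (g₃ x) x)
    (hB : ∀ x, |x - a| ≤ h → |g₃ x| ≤ B) (hs : 0 ≤ s) (hsh : s ≤ h) :
    |g (a + s) - g (a - s) - 2 * s * g₁ a| ≤ 2 * B * s ^ 3 := by
  have hB0 : 0 ≤ B := (abs_nonneg _).trans (hB a (by simpa using hs.trans hsh))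
  refine abs_le_mul_pow_of_abs_deriv_le (n := 2)
    (g := fun s => g (a + s) - g (a - s) - 2 * s * g₁ a)
    (fun s => (((hg _).comp_const_add a s).sub ((hg _).comp_const_sub a s)).sub
      (((hasDerivAt_id s).const_mul 2).mul_const (g₁ a)))
    (by simp) (by positivity) (fun r hr hrh => ?_) hs hsh
  rw [sub_neg_eq_add, mul_one]
  exact abs_reflect_add_sub_le hg₁ hg₂ hB hr hrh

theorem abs_reflect_add_sub_sub_le (hg : ∀ x, HasDerivAt g (g₁ x) x)
    (hg₁ : ∀ x, HasDerivAt g₁ (g₂ x) x) (hg₂ : ∀ x, HasDerivAt g₂ (g₃ x) x)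
    (hg₃ : ∀ x, HasDerivAt g₃ (g₄ x) x) (hB : ∀ x, |x - a| ≤ h → |g₄ x| ≤ B) (hs : 0 ≤ s)
    (hsh : s ≤ h) : |g (a + s) + g (a - s) - 2 * g a - s ^ 2 * g₂ a| ≤ 2 * B * s ^ 4 := by
  have hB0 : 0 ≤ B := (abs_nonneg _).trans (hB a (by simpa using hs.trans hsh))
  refine abs_le_mul_pow_of_abs_deriv_le (n := 3)
    (g := fun s => g (a + s) + g (a - s) - 2 * g a - s ^ 2 * g₂ a)
    (fun s => ((((hg _).comp_const_add a s).add ((hg _).comp_const_sub a s)).sub_const _).sub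
      ((hasDerivAt_pow 2 s).mul_const (g₂ a)))
    (by simp only [add_zero, sub_zero]; ring) (by positivity) (fun r hr hrh => ?_) hs hsh
  simpa [← sub_eq_add_neg] using abs_reflect_sub_sub_le hg₁ hg₂ hg₃ hB hr hrh

end SymmetricDifference

theorem abs_sqrt_one_add_sub_le {ε : ℝ} (hε : -1 ≤ ε) : |√(1 + ε) - (1 + ε / 2)| ≤ ε ^ 2 / 2 := by
  obtain ⟨y, hy, rfl⟩ : ∃ y, 0 ≤ y ∧ ε = y ^ 2 - 1 :=
    ⟨√(1 + ε), Real.sqrt_nonneg _, by rw [Real.sq_sqrt (by linarith)]; ring⟩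
  rw [add_sub_cancel, Real.sqrt_sq hy, show y - (1 + (y ^ 2 - 1) / 2) = -((y - 1) ^ 2 / 2) by ring,
    abs_neg, abs_of_nonneg (by positivity)]
  have hone : 1 ≤ (y + 1) ^ 2 := one_le_pow₀ (by linarith)
  calc (y - 1) ^ 2 / 2 ≤ (y - 1) ^ 2 * (y + 1) ^ 2 / 2 := by
        gcongr
        exact le_mul_of_one_le_right (sq_nonneg _) hone
    _ = (y ^ 2 - 1) ^ 2 / 2 := by ring

theorem abs_le_one_add_sq (a : ℝ) : |a| ≤ 1 + a ^ 2 := by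
  nlinarith [sq_nonneg (|a| - 1), sq_abs a, abs_nonneg a]

theorem hopping_sub_step (h a : ℝ) : hopping h (a - h) = hopping h (-a) := by
  rw [hopping, hopping]
  congr 2
  ring

theorem abs_hopping_sub_le {a h : ℝ} (h0 : 0 < h) (h1 : h ≤ 1) (ha : |a * h| ≤ 1) :
    |hopping h a - (1 / h ^ 2 + (1 - a ^ 2 - a * h) / 2)| ≤ 2 * h ^ 2 * (1 + a ^ 2) ^ 2 := by
  obtain ⟨hlow, hup⟩ := abs_le.1 ha
  set η := 1 - a ^ 2 - a * h with hη
  have hη_le : |η| ≤ 2 * (1 + a ^ 2) := by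
    have hah : |a * h| ≤ 1 + a ^ 2 := by
      rw [abs_mul, abs_of_pos h0]
      exact (mul_le_of_le_one_right (abs_nonneg a) h1).trans (abs_le_one_add_sq a)
    rw [abs_le] at hah ⊢
    constructor <;> nlinarith [sq_nonneg a]
  have hprod : (1 + a * h + h ^ 2) * (1 - a * h) = 1 + h ^ 2 * η := by rw [hη]; ring
  have hpos : 0 ≤ 1 + h ^ 2 * η := by
    rw [← hprod]
    exact mul_nonneg (by nlinarith) (by linarith)
  have hscale : hopping h a - (1 / h ^ 2 + η / 2)
      = 1 / h ^ 2 * (√(1 + h ^ 2 * η) - (1 + h ^ 2 * η / 2)) := by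
    rw [hopping, hprod]
    field_simp
  calc |hopping h a - (1 / h ^ 2 + η / 2)|
      = 1 / h ^ 2 * |√(1 + h ^ 2 * η) - (1 + h ^ 2 * η / 2)| := by
        rw [hscale, abs_mul, abs_of_pos (by positivity)]
    _ ≤ 1 / h ^ 2 * ((h ^ 2 * η) ^ 2 / 2) := by
        gcongr
        exact abs_sqrt_one_add_sub_le (by linarith)
    _ = h ^ 2 * |η| ^ 2 / 2 := by
        rw [sq_abs]
        field_simp
    _ ≤ h ^ 2 * (2 * (1 + a ^ 2)) ^ 2 / 2 := by gcongr
    _ = 2 * h ^ 2 * (1 + a ^ 2) ^ 2 := by ring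

theorem kravchuk_residual_eq (a h lam p q z s₁ s₂ : ℝ) :
    -s₁ * p - s₂ * q + (1 + 2 / h ^ 2) * z - lam * z
      = -(1 / h ^ 2 * (p + q - 2 * z) - (a ^ 2 - lam) * z) - (1 - a ^ 2) / 2 * (p + q - 2 * z)
        + a * h / 2 * (p - q) - (s₁ - (1 / h ^ 2 + (1 - a ^ 2 - a * h) / 2)) * p
        - (s₂ - (1 / h ^ 2 + (1 - a ^ 2 + a * h) / 2)) * q := by
  ring

theorem abs_kravchuk_residual_le_of_abs_differences_le {a h B lam p q z : ℝ} (h0 : 0 < h)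
    (h1 : h ≤ 1) (ha : |a * h| ≤ 1) (hp : |p| ≤ B) (hq : |q| ≤ B) (hodd : |p - q| ≤ 2 * B * h)
    (heven : |p + q - 2 * z| ≤ 2 * B * h ^ 2)
    (htaylor : |p + q - 2 * z - h ^ 2 * ((a ^ 2 - lam) * z)| ≤ 2 * B * h ^ 4) :
    |-hopping h a * p - hopping h (a - h) * q + (1 + 2 / h ^ 2) * z - lam * z|
      ≤ 8 * h ^ 2 * (B * (1 + a ^ 2) ^ 2) := by
  have hs₁ := abs_hopping_sub_le h0 h1 ha
  have hs₂ := abs_hopping_sub_le h0 h1 (a := -a) (by rwa [neg_mul, abs_neg])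
  rw [neg_sq, neg_mul, sub_neg_eq_add] at hs₂
  rw [hopping_sub_step, kravchuk_residual_eq a]
  have hB : 0 ≤ B := (abs_nonneg _).trans hp
  set w := 1 + a ^ 2 with hw
  have hw1 : 1 ≤ w := by linarith [sq_nonneg a]
  have hdiffusion : |1 / h ^ 2 * (p + q - 2 * z) - (a ^ 2 - lam) * z| ≤ 2 * B * h ^ 2 := by
    rw [show 1 / h ^ 2 * (p + q - 2 * z) - (a ^ 2 - lam) * z
      = (p + q - 2 * z - h ^ 2 * ((a ^ 2 - lam) * z)) / h ^ 2 by field_simp, abs_div,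
      abs_of_pos (pow_pos h0 2), div_le_iff₀ (pow_pos h0 2)]
    linarith
  have hpotential : |(1 - a ^ 2) / 2 * (p + q - 2 * z)| ≤ w / 2 * (2 * B * h ^ 2) := by
    rw [abs_mul]
    gcongr
    rw [abs_le]
    constructor <;> linarith [sq_nonneg a]
  have hdrift : |a * h / 2 * (p - q)| ≤ w * h / 2 * (2 * B * h) := by
    rw [abs_mul, abs_div, abs_mul, abs_of_pos h0, abs_two]
    gcongr
    exact abs_le_one_add_sq a
  have hhop₁ := (abs_mul _ p).trans_le (mul_le_mul hs₁ hp (abs_nonneg _) (by positivity))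
  have hhop₂ := (abs_mul _ q).trans_le (mul_le_mul hs₂ hq (abs_nonneg _) (by positivity))
  have hconst : B * h ^ 2 ≤ B * h ^ 2 * w ^ 2 := le_mul_of_one_le_right (by positivity)
    (one_le_pow₀ hw1)
  have hlinear : B * h ^ 2 * w ≤ B * h ^ 2 * w ^ 2 := by
    gcongr
    exact le_self_pow₀ hw1 two_ne_zero
  rw [abs_le] at *
  constructor <;> linarith

theorem abs_kravchuk_residual_le {g : ℝ → ℝ} {a h B lam : ℝ} (hg : ContDiff ℝ 4 g) (h0 : 0 < h)
    (h1 : h ≤ 1) (ha : |a * h| ≤ 1) (hB : ∀ x, |x - a| ≤ h → ∀ k ≤ 4, |iteratedDeriv k g x| ≤ B)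
    (hode : iteratedDeriv 2 g a = (a ^ 2 - lam) * g a) :
    |-hopping h a * g (a + h) - hopping h (a - h) * g (a - h) + (1 + 2 / h ^ 2) * g a - lam * g a|
      ≤ 8 * h ^ 2 * (B * (1 + a ^ 2) ^ 2) := by
  have hd (k : ℕ) (hk : k < 4) (x : ℝ) :
      HasDerivAt (iteratedDeriv k g) (iteratedDeriv (k + 1) g x) x := by
    rw [iteratedDeriv_succ]
    exact (hg.differentiable_iteratedDeriv k (by exact_mod_cast hk) x).hasDerivAt
  have hBk (k : ℕ) (hk : k ≤ 4) (x : ℝ) (hx : |x - a| ≤ h) := hB x hx k hk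
  have hp : |g (a + h)| ≤ B := by simpa using hBk 0 (by simp) (a + h) (by simp [abs_of_pos h0])
  have hq : |g (a - h)| ≤ B := by simpa using hBk 0 (by simp) (a - h) (by simp [abs_of_pos h0])
  have hodd := abs_reflect_sub_le (hd 0 (by simp)) (hBk 1 (by simp)) h0.le le_rfl
  have heven := abs_reflect_add_sub_le (hd 0 (by simp)) (hd 1 (by simp)) (hBk 2 (by simp)) h0.le
    le_rfl
  have htaylor := abs_reflect_add_sub_sub_le (hd 0 (by simp)) (hd 1 (by simp)) (hd 2 (by simp))
    (hd 3 (by simp)) (hBk 4 le_rfl) h0.le le_rfl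
  simp only [iteratedDeriv_zero, hode] at hodd heven htaylor
  exact abs_kravchuk_residual_le_of_abs_differences_le h0 h1 ha hp hq hodd heven htaylor

theorem one_add_sq_le_three_mul {a x : ℝ} (hx : |x - a| ≤ 1) : 1 + a ^ 2 ≤ 3 * (1 + x ^ 2) := by
  nlinarith [sq_nonneg (2 * x - a), sq_le_one_iff_abs_le_one (x - a) |>.2 hx]

theorem iteratedDeriv_two_hermiteFun (n : ℕ) (x : ℝ) :
    iteratedDeriv 2 (hermiteFun n) x = (x ^ 2 - (2 * n + 1)) * hermiteFun n x := by
  rw [iteratedDeriv_succ, iteratedDeriv_one]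
  exact (hasDerivAt_deriv_hermiteFun n x).deriv

theorem norm_kravchukOscillator_hermiteFun_sub_le {h K : ℝ} (h0 : 0 < h) (h1 : h ≤ 1) {m : ℕ}
    (hK : ∀ x, ∀ k ≤ 4, (1 + x ^ 2) ^ 3 * |iteratedDeriv k (hermiteFun m) x| ≤ K) {a : Grid h}
    (ha : InA h a) :
    ‖kravchukOscillator h (fun b => (hermiteFun m b : ℂ)) a - (2 * m + 1) * hermiteFun m a‖
      ≤ 216 * K * h ^ 2 / (1 + (a : ℝ) ^ 2) := by
  have hlocal : ∀ x : ℝ, |x - a| ≤ h → ∀ k ≤ 4,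
      |iteratedDeriv k (hermiteFun m) x| ≤ 27 * K / (1 + (a : ℝ) ^ 2) ^ 3 := by
    intro x hx k hk
    rw [le_div_iff₀ (by positivity)]
    calc |iteratedDeriv k (hermiteFun m) x| * (1 + (a : ℝ) ^ 2) ^ 3
        ≤ |iteratedDeriv k (hermiteFun m) x| * (3 * (1 + x ^ 2)) ^ 3 := by
          gcongr
          exact one_add_sq_le_three_mul (hx.trans h1)
      _ = 27 * ((1 + x ^ 2) ^ 3 * |iteratedDeriv k (hermiteFun m) x|) := by ring
      _ ≤ 27 * K := by gcongr; exact hK x k hk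
  have hresidual := abs_kravchuk_residual_le (contDiff_infty.1 (contDiff_hermiteFun m) 4) h0 h1
    (ha.abs_mul_le_one h0) hlocal (iteratedDeriv_two_hermiteFun m a)
  rw [kravchukOscillator_of_mem ha, coe_add_step, coe_sub_step]
  rw [← Real.norm_eq_abs, ← Complex.norm_real] at hresidual
  push_cast at hresidual ⊢
  refine hresidual.trans_eq ?_
  field_simp
  ring

/-! ### Square-summable grid functions -/

section Ell2

variable {h : ℝ}

theorem memℓp_two_iff (u : Grid h → ℂ) : Memℓp u 2 ↔ MemEll2 h u := by
  rw [memℓp_gen_iff (by norm_num)]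
  simp [MemEll2]

theorem ell2Norm_coe (h0 : 0 < h) (x : lp (fun _ : Grid h => ℂ) 2) :
    ell2Norm h x = √h * ‖x‖ := by
  have hnorm : ‖x‖ ^ 2 = ∑' a, ‖x a‖ ^ 2 := by
    simpa using lp.norm_rpow_eq_tsum (p := 2) (by norm_num) x
  rw [ell2Norm, ← hnorm, Real.sqrt_mul h0.le, Real.sqrt_sq (norm_nonneg _)]

theorem MemEll2.add {u v : Grid h → ℂ} (hu : MemEll2 h u) (hv : MemEll2 h v) :
    MemEll2 h (u + v) :=
  (memℓp_two_iff _).1 (((memℓp_two_iff u).2 hu).add ((memℓp_two_iff v).2 hv))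

theorem MemEll2.const_mul {u : Grid h → ℂ} (hu : MemEll2 h u) (c : ℂ) :
    MemEll2 h fun a => c * u a := by
  simp only [MemEll2, norm_mul, mul_pow]
  exact hu.mul_left _

theorem ell2Norm_add_le (h0 : 0 < h) {u v : Grid h → ℂ} (hu : MemEll2 h u) (hv : MemEll2 h v) :
    ell2Norm h (u + v) ≤ ell2Norm h u + ell2Norm h v := by
  let x : lp (fun _ : Grid h => ℂ) 2 := ⟨u, (memℓp_two_iff u).2 hu⟩
  let y : lp (fun _ : Grid h => ℂ) 2 := ⟨v, (memℓp_two_iff v).2 hv⟩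
  calc ell2Norm h (u + v) = √h * ‖x + y‖ := ell2Norm_coe h0 (x + y)
    _ ≤ √h * (‖x‖ + ‖y‖) := by gcongr; exact norm_add_le x y
    _ = ell2Norm h u + ell2Norm h v := by rw [mul_add, ← ell2Norm_coe h0, ← ell2Norm_coe h0]

theorem ell2Norm_const_mul (c : ℂ) (u : Grid h → ℂ) :
    ell2Norm h (fun a => c * u a) = ‖c‖ * ell2Norm h u := by
  simp only [ell2Norm, norm_mul, mul_pow]
  rw [tsum_mul_left, mul_left_comm, Real.sqrt_mul (sq_nonneg _), Real.sqrt_sq (norm_nonneg _)]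

theorem memEll2_and_ell2Norm_le_of_hasSum (h0 : 0 < h) {u : ℕ → Grid h → ℂ} {v : Grid h → ℂ}
    {B : ℕ → ℝ} {S : ℝ} (hu : ∀ m, MemEll2 h (u m)) (huB : ∀ m, ell2Norm h (u m) ≤ B m)
    (hB : HasSum B S) (hv : ∀ a, HasSum (fun m => u m a) (v a)) :
    MemEll2 h v ∧ ell2Norm h v ≤ S := by
  let x (m : ℕ) : lp (fun _ : Grid h => ℂ) 2 := ⟨u m, (memℓp_two_iff _).2 (hu m)⟩
  have hsqrt : 0 < √h := Real.sqrt_pos.2 h0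
  have hxB (m : ℕ) : ‖x m‖ ≤ B m / √h := by
    rw [le_div_iff₀ hsqrt, mul_comm, ← ell2Norm_coe h0]
    exact huB m
  have hxS : HasSum (fun m => B m / √h) (S / √h) := hB.div_const _
  obtain ⟨y, hy⟩ : Summable x := .of_norm_bounded hxS.summable hxB
  obtain rfl : (y : Grid h → ℂ) = v := funext fun a =>
    (hy.map ((Pi.evalAddMonoidHom (fun _ : Grid h => ℂ) a).comp (lp _ 2).subtype)
      (lp.lipschitzWith_one_eval 2 a).continuous).unique (hv a)
  refine ⟨(memℓp_two_iff _).1 (lp.memℓp y), ?_⟩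
  rw [ell2Norm_coe h0, mul_comm, ← le_div_iff₀ hsqrt, ← hy.tsum_eq]
  exact tsum_of_norm_bounded hxS hxB

theorem mul_sum_range_inv_one_add_sq_le (h0 : 0 < h) (n : ℕ) :
    h * ∑ k ∈ Finset.range n, 1 / (1 + (((k + 1 : ℕ) : ℝ) * h) ^ 2) ≤ Real.pi / 2 := by
  have hanti : AntitoneOn (fun x => 1 / (1 + (x * h) ^ 2)) (Set.Icc 0 (0 + n : ℝ)) := by
    intro x hx y _ hxy
    have := hx.1
    dsimp only
    gcongr
  have hintegral := hanti.sum_le_integral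
  simp only [zero_add] at hintegral
  calc h * ∑ k ∈ Finset.range n, 1 / (1 + (((k + 1 : ℕ) : ℝ) * h) ^ 2)
      ≤ h * ∫ x in (0 : ℝ)..n, 1 / (1 + (x * h) ^ 2) := by gcongr
    _ = Real.arctan (n * h) := by
      rw [intervalIntegral.mul_integral_comp_mul_right (f := fun y => 1 / (1 + y ^ 2)),
        integral_one_div_one_add_sq, zero_mul, Real.arctan_zero, sub_zero]
    _ ≤ Real.pi / 2 := (Real.arctan_lt_pi_div_two _).le

theorem exists_hasSum_grid_inv_one_add_sq (h0 : 0 < h) :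
    ∃ S, HasSum (fun a : Grid h => 1 / (1 + (a : ℝ) ^ 2)) S ∧ h * S ≤ h + Real.pi := by
  let w (n : ℕ) : ℝ := 1 / (1 + (((n + 1 : ℕ) : ℝ) * h) ^ 2)
  have hpartial (n : ℕ) : ∑ k ∈ Finset.range n, w k ≤ Real.pi / 2 / h := by
    rw [le_div_iff₀' h0]
    exact mul_sum_range_inv_one_add_sq_le h0 n
  have hw : ∀ n, 0 ≤ w n := fun n => by positivity
  obtain ⟨S, hS⟩ := summable_of_sum_range_le hw hpartial
  have hSle : S ≤ Real.pi / 2 / h := hS.tsum_eq ▸ Real.tsum_le_of_sum_range_le hw hpartial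
  have hint : HasSum (fun k : ℤ => 1 / (1 + (k * h) ^ 2)) (S + 1 / (1 + ((0 : ℤ) * h) ^ 2) + S) :=
    HasSum.of_add_one_of_neg_add_one (f := fun k : ℤ => 1 / (1 + (k * h) ^ 2))
      (by simpa [w] using hS) (hS.congr_fun fun n => by simp only [w]; push_cast; ring)
  refine ⟨_, ((Equiv.ofBijective (pt h) ⟨pt_injective h0, pt_surjective h⟩).hasSum_iff).1 hint, ?_⟩
  rw [le_div_iff₀ h0] at hSle
  simp only [Int.cast_zero, zero_mul, ne_eq, OfNat.ofNat_ne_zero, not_false_eq_true, zero_pow,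
    add_zero, div_one]
  linarith

theorem memEll2_and_ell2Norm_le_of_decay (h0 : 0 < h) (h1 : h ≤ 1) {u : Grid h → ℂ} {C : ℝ}
    (hC : 0 ≤ C) (hu : ∀ a, ‖u a‖ ≤ C / (1 + (a : ℝ) ^ 2)) :
    MemEll2 h u ∧ ell2Norm h u ≤ 3 * C := by
  obtain ⟨S, hS, hSle⟩ := exists_hasSum_grid_inv_one_add_sq h0
  have hsq (a : Grid h) : ‖u a‖ ^ 2 ≤ C ^ 2 * (1 / (1 + (a : ℝ) ^ 2)) := by
    calc ‖u a‖ ^ 2 ≤ (C / (1 + (a : ℝ) ^ 2)) ^ 2 := by gcongr; exact hu a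
      _ = C ^ 2 * (1 / (1 + (a : ℝ) ^ 2) ^ 2) := by rw [div_pow, mul_one_div]
      _ ≤ C ^ 2 * (1 / (1 + (a : ℝ) ^ 2)) := by
        gcongr
        exact le_self_pow₀ (by linarith [sq_nonneg (a : ℝ)]) two_ne_zero
  have hsum : Summable fun a => ‖u a‖ ^ 2 :=
    .of_nonneg_of_le (fun _ => sq_nonneg _) hsq (hS.summable.mul_left _)
  refine ⟨hsum, Real.sqrt_le_iff.2 ⟨by positivity, ?_⟩⟩
  calc h * ∑' a, ‖u a‖ ^ 2 ≤ h * (C ^ 2 * S) := by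
        gcongr
        exact hasSum_le hsq hsum.hasSum (hS.mul_left _)
    _ = C ^ 2 * (h * S) := by ring
    _ ≤ C ^ 2 * 9 := by
        gcongr
        linarith [Real.pi_lt_four]
    _ = (3 * C) ^ 2 := by ring

end Ell2

namespace IsMesh

variable {M : ℕ} {h : ℝ}

theorem le_one (hm : IsMesh M h) : h ≤ 1 := by
  have hM : M ≠ 0 := by
    rintro rfl
    simpa using hm.sq_mul
  refine (sq_le_one_iff₀ hm.pos.le).1 ?_
  rw [← hm.sq_mul]
  exact le_mul_of_one_le_right (sq_nonneg h) (by exact_mod_cast Nat.one_le_iff_ne_zero.2 hM)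

theorem hasSum_of_eq_zero_of_notMem {E : Type*} [AddCommMonoid E] [TopologicalSpace E]
    (hm : IsMesh M h) {F : Grid h → E} (hF : ∀ a, ¬ InA h a → F a = 0) :
    HasSum F (∑ j ∈ Finset.range (2 * M + 1), F (node M h j)) := by
  have hinj : Function.Injective (node M h) := fun i j hij => by
    have := pt_injective hm.pos hij
    omega
  have hsum := hasSum_sum_of_ne_finset_zero (f := F)
    (s := (Finset.range (2 * M + 1)).map ⟨_, hinj⟩) (L := .unconditional _)
    fun a ha => hF a fun hA => ha <| by
      obtain ⟨j, hj, rfl⟩ := hm.exists_eq_node hA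
      exact Finset.mem_map_of_mem _ (Finset.mem_range_succ_iff.2 hj)
  rwa [Finset.sum_map] at hsum

theorem indicator_node (hm : IsMesh M h) (u : Grid h → ℂ) {j : ℕ}
    (hj : j ∈ Finset.range (2 * M + 1)) :
    Set.indicator {a | InA h a} u (node M h j) = u (node M h j) :=
  Set.indicator_of_mem (s := {a | InA h a}) (hm.inA_node (Finset.mem_range_succ_iff.1 hj)) u

theorem memEll2_and_ell2Norm_indicator (hm : IsMesh M h) (u : Grid h → ℂ) :
    MemEll2 h (Set.indicator {a | InA h a} u) ∧
      ell2Norm h (Set.indicator {a | InA h a} u) = ‖toVec M h u‖ := by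
  have hsum := hm.hasSum_of_eq_zero_of_notMem
    (F := fun a => ‖Set.indicator {a | InA h a} u a‖ ^ 2)
    fun a ha => by simp [Set.indicator_of_notMem (s := {a | InA h a}) ha]
  refine ⟨hsum.summable, ?_⟩
  rw [ell2Norm, hsum.tsum_eq, Finset.sum_congr rfl fun j hj => by rw [hm.indicator_node u hj],
    ← hm.norm_sq_toVec, Real.sqrt_sq (norm_nonneg _)]

theorem norm_toVec_le_of_decay (hm : IsMesh M h) {u : Grid h → ℂ} {C : ℝ} (hC : 0 ≤ C)
    (hu : ∀ a, InA h a → ‖u a‖ ≤ C / (1 + (a : ℝ) ^ 2)) : ‖toVec M h u‖ ≤ 3 * C := by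
  rw [← (hm.memEll2_and_ell2Norm_indicator u).2]
  refine (memEll2_and_ell2Norm_le_of_decay hm.pos hm.le_one hC fun a => ?_).2
  by_cases ha : InA h a
  · rw [Set.indicator_of_mem (by exact ha)]
    exact hu a ha
  · rw [Set.indicator_of_notMem (by exact ha), norm_zero]
    positivity

theorem memEll2_and_ell2Norm_le (hm : IsMesh M h) {u : Grid h → ℂ} {C : ℝ} (hC : 0 ≤ C)
    (hu : ∀ a, ¬ InA h a → ‖u a‖ ≤ C / (1 + (a : ℝ) ^ 2)) :
    MemEll2 h u ∧ ell2Norm h u ≤ ‖toVec M h u‖ + 3 * C := by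
  obtain ⟨hin, hinNorm⟩ := hm.memEll2_and_ell2Norm_indicator u
  obtain ⟨hout, houtNorm⟩ := memEll2_and_ell2Norm_le_of_decay hm.pos hm.le_one
    (u := Set.indicator {a | InA h a}ᶜ u) hC fun a => by
      by_cases ha : InA h a
      · rw [Set.indicator_of_notMem (by exact not_not.2 ha), norm_zero]
        positivity
      · rw [Set.indicator_of_mem (by exact ha)]
        exact hu a ha
  rw [← Set.indicator_self_add_compl {a | InA h a} u]
  refine ⟨hin.add hout, (ell2Norm_add_le hm.pos hin hout).trans ?_⟩
  rw [Set.indicator_self_add_compl, hinNorm]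
  gcongr

end IsMesh

/-! ### Discretization error of a single mode -/

theorem norm_hermiteFun_le {K : ℝ} {m : ℕ}
    (hK : ∀ x, ∀ k ≤ 4, (1 + x ^ 2) ^ 3 * |iteratedDeriv k (hermiteFun m) x| ≤ K) (x : ℝ) :
    ‖(hermiteFun m x : ℂ)‖ ≤ K / (1 + x ^ 2) ^ 2 := by
  have hK0 := hK x 0 (Nat.zero_le _)
  rw [iteratedDeriv_zero, ← Real.norm_eq_abs, ← Complex.norm_real] at hK0
  rw [le_div_iff₀' (by positivity)]
  refine le_trans ?_ hK0
  gcongr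
  · linarith [sq_nonneg x]
  · norm_num

theorem truncationError_of_notMem {M : ℕ} {h : ℝ} {a : Grid h} (ha : ¬ InA h a) (e : ℕ → ℂ)
    (nmax m : ℕ) (u : Grid h → ℂ) : truncationError M h e nmax m u a = e m * u a := by
  simp [truncationError, kravchukFun, rho_of_notMem ha]

theorem one_div_one_add_sq_le {h : ℝ} (h0 : 0 < h) {a : Grid h} (ha : ¬ InA h a) :
    1 / (1 + (a : ℝ) ^ 2) ≤ h ^ 2 := by
  rw [InA, Set.mem_Icc, ← abs_le, not_le] at ha
  have hsq : (1 / h) ^ 2 < (a : ℝ) ^ 2 := sq_abs (a : ℝ) ▸ pow_lt_pow_left₀ ha (by positivity)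
    two_ne_zero
  rw [div_le_comm₀ (by positivity) (by positivity), ← one_div_pow]
  linarith

theorem IsMesh.memEll2_and_ell2Norm_truncationError_le {M : ℕ} {h : ℝ} (hm : IsMesh M h) {K : ℝ}
    {m : ℕ} (hK : ∀ x, ∀ k ≤ 4, (1 + x ^ 2) ^ 3 * |iteratedDeriv k (hermiteFun m) x| ≤ K)
    {e : ℕ → ℂ} (he : ∀ n, ‖e n‖ = 1) (nmax : ℕ) :
    MemEll2 h (truncationError M h e nmax m fun b => (hermiteFun m b : ℂ)) ∧
      ell2Norm h (truncationError M h e nmax m fun b => (hermiteFun m b : ℂ))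
        ≤ 651 * K * if m ≤ nmax then h ^ 2 else 1 := by
  have h0 := hm.pos
  have hK0 : 0 ≤ K := le_trans (by positivity) (hK 0 0 (Nat.zero_le _))
  obtain ⟨hmem, hnorm⟩ := hm.memEll2_and_ell2Norm_le (C := K * h ^ 2) (by positivity)
    (u := truncationError M h e nmax m fun b => (hermiteFun m b : ℂ)) fun a ha => by
      rw [truncationError_of_notMem ha, norm_mul, he, one_mul]
      calc ‖(hermiteFun m a : ℂ)‖ ≤ K / (1 + (a : ℝ) ^ 2) ^ 2 := norm_hermiteFun_le hK a
        _ = K * (1 / (1 + (a : ℝ) ^ 2)) / (1 + (a : ℝ) ^ 2) := by field_simp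
        _ ≤ K * h ^ 2 / (1 + (a : ℝ) ^ 2) := by
          gcongr
          exact one_div_one_add_sq_le h0 ha
  refine ⟨hmem, hnorm.trans ?_⟩
  split_ifs with hmn
  · have hresidual := (hm.norm_toVec_truncationError_le_residual he hmn _).trans
      (hm.norm_toVec_le_of_decay (C := 216 * K * h ^ 2) (by positivity)
        fun a ha => norm_kravchukOscillator_hermiteFun_sub_le h0 hm.le_one hK ha)
    linarith
  · have htrivial := hm.norm_toVec_le_of_decay (u := fun b => (hermiteFun m b : ℂ)) hK0
      fun a _ => (norm_hermiteFun_le hK a).trans <| by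
        gcongr
        exact le_self_pow₀ (by linarith [sq_nonneg (a : ℝ)]) two_ne_zero
    have hstable := hm.norm_toVec_truncationError_le he nmax m fun b => (hermiteFun m b : ℂ)
    have hh : K * h ^ 2 ≤ K := mul_le_of_le_one_right hK0 (pow_le_one₀ h0.le hm.le_one)
    linarith

/-! ### Error of the discrete evolution -/

namespace IsMesh

variable {M : ℕ} {h : ℝ}

theorem kravchukCoeff_eq_gridPairing (hm : IsMesh M h) (f : ℝ → ℂ) (n : ℕ) :
    kravchukCoeff f n h
      = gridPairing M h (restrict h f) fun a => (kravchukFun n h a : ℂ) := by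
  rw [kravchukCoeff, gridPairing, (hm.hasSum_of_eq_zero_of_notMem fun a ha => by simp [ha]).tsum_eq]
  congr 1
  refine Finset.sum_congr rfl fun j hj => ?_
  rw [if_pos (hm.inA_node (Finset.mem_range_succ_iff.1 hj))]

theorem hasSum_kravchukCoeff (hm : IsMesh M h) (f : 𝓢(ℝ, ℂ)) (n : ℕ) :
    HasSum (fun m => hermiteCoeff f m *
        gridPairing M h (fun b => (hermiteFun m b : ℂ)) fun a => (kravchukFun n h a : ℂ))
      (kravchukCoeff f n h) := by
  rw [hm.kravchukCoeff_eq_gridPairing, gridPairing]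
  refine ((hasSum_sum fun j _ =>
    (hasSum_hermiteCoeff_mul_hermiteFun f (node M h j)).mul_right _).mul_left _).congr_fun
      fun m => ?_
  rw [gridPairing, mul_left_comm, Finset.mul_sum]
  simp only [mul_assoc]

theorem hasSum_truncationError (hm : IsMesh M h) (f : 𝓢(ℝ, ℂ)) (nmax : ℕ) (t : ℝ) (a : Grid h) :
    HasSum (fun m => hermiteCoeff f m *
        truncationError M h (fun n => Complex.exp (-Complex.I * (2 * n + 1) * t)) nmax m
          (fun b => (hermiteFun m b : ℂ)) a)
      (restrict h (evolution f t) a - discreteEvolution f nmax h t a) := by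
  refine ((summable_evolutionTerm f t a).hasSum.sub (hasSum_sum fun n _ =>
    ((hm.hasSum_kravchukCoeff f n).mul_right _).mul_right _)).congr_fun fun m => ?_
  rw [truncationError, evolutionTerm, mul_sub, Finset.mul_sum]
  simp only [mul_assoc, mul_left_comm]

end IsMesh

theorem ite_le_add_div_pow {x : ℝ} (hx : 0 ≤ x) (m n σ : ℕ) :
    (if m ≤ n then x else 1) ≤ x + (((m : ℝ) + 1) / (n + 1)) ^ σ := by
  split_ifs with hmn
  · exact le_add_of_nonneg_right (by positivity)
  · refine le_add_of_nonneg_of_le hx (one_le_pow₀ ((one_le_div (by positivity)).2 ?_))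
    gcongr
    exact (not_le.1 hmn).le

theorem exists_ell2Norm_evolution_sub_discreteEvolution_le (f : 𝓢(ℝ, ℂ)) :
    ∃ C, 0 ≤ C ∧ ∃ A : ℕ → ℝ, (∀ σ, 0 ≤ A σ) ∧
      ∀ {M : ℕ} {h : ℝ}, IsMesh M h → ∀ (nmax : ℕ) (t : ℝ) (σ : ℕ),
        MemEll2 h (fun a => restrict h (evolution f t) a - discreteEvolution f nmax h t a) ∧
        ell2Norm h (fun a => restrict h (evolution f t) a - discreteEvolution f nmax h t a)
          ≤ C * h ^ 2 + A σ / ((nmax : ℝ) + 1) ^ σ := by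
  obtain ⟨K, p, hK, hweight⟩ := exists_weight_mul_iteratedDeriv_hermiteFun_le 3 4
  refine ⟨651 * K * ∑' m, ‖hermiteCoeff f m‖ * ((m : ℝ) + 1) ^ p, by positivity,
    fun σ => 651 * K * ∑' m, ‖hermiteCoeff f m‖ * ((m : ℝ) + 1) ^ (p + σ),
    fun σ => by positivity, fun {M h} hm nmax t σ => ?_⟩
  have hphase (n : ℕ) : ‖Complex.exp (-Complex.I * (2 * n + 1) * t)‖ = 1 := by
    simpa using norm_exp_neg_I_mul (2 * n + 1) t
  have hmode (m : ℕ) := hm.memEll2_and_ell2Norm_truncationError_le (hweight m) hphase nmax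
  have hbound : HasSum (fun m : ℕ => ‖hermiteCoeff f m‖ *
      (651 * (K * ((m : ℝ) + 1) ^ p) * (h ^ 2 + (((m : ℝ) + 1) / (nmax + 1)) ^ σ))) _ :=
    (((summable_norm_hermiteCoeff_mul_pow f p).hasSum.mul_left (651 * K * h ^ 2)).add
      ((summable_norm_hermiteCoeff_mul_pow f (p + σ)).hasSum.mul_left
        (651 * K / ((nmax : ℝ) + 1) ^ σ))).congr_fun fun m => by
          rw [div_pow, pow_add]
          ring
  obtain ⟨hmem, hle⟩ := memEll2_and_ell2Norm_le_of_hasSum hm.pos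
    (fun m => (hmode m).1.const_mul (hermiteCoeff f m))
    (fun m => by
      rw [ell2Norm_const_mul]
      gcongr
      refine (hmode m).2.trans ?_
      gcongr
      exact ite_le_add_div_pow (sq_nonneg h) m nmax σ)
    hbound (hm.hasSum_truncationError f nmax t)
  exact ⟨hmem, hle.trans_eq (by ring)⟩

theorem IsMesh.of_eq {N : ℕ} {h : ℝ} (hN : 0 < N) (hev : Even N)
    (hh : h = √2 * (N : ℝ) ^ (-(1 / 2) : ℝ)) : ∃ M : ℕ, N = 2 * M ∧ IsMesh M h := by
  obtain ⟨M, rfl⟩ := hev.two_dvd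
  have hN' : (0 : ℝ) < (2 * M : ℕ) := by exact_mod_cast hN
  have hM : (M : ℝ) ≠ 0 := by
    rintro hM
    simp [hM] at hN'
  refine ⟨M, rfl, hh ▸ by positivity, ?_⟩
  rw [hh, mul_pow, Real.sq_sqrt zero_le_two, ← Real.rpow_mul_natCast hN'.le]
  norm_num [Real.rpow_neg_one]
  field_simp

/-! ### Cutoffs in the logarithmic window -/

section Cutoff

variable {h δ : ℝ}

theorem le_two_div_sq_of_le_log (h0 : 0 < h) (h1 : h ≤ 1) (hhδ : h * δ ≤ 6) {x : ℝ}
    (hx : x ≤ 1 / 3 * δ * |Real.log h|) : x ≤ 2 / h ^ 2 := by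
  have hlog : |Real.log h| * h ≤ 1 := by
    simpa only [abs_mul, abs_of_pos h0] using (Real.abs_log_mul_self_lt h h0 h1).le
  rw [le_div_iff₀ (by positivity)]
  calc x * h ^ 2 ≤ 1 / 3 * δ * |Real.log h| * h ^ 2 := by gcongr
    _ = 1 / 3 * (h * δ) * (|Real.log h| * h) := by ring
    _ ≤ 1 / 3 * 6 * 1 := by gcongr
    _ = 2 := by norm_num

theorem div_succ_pow_le_one_div_rpow {A L s : ℝ} {n σ : ℕ} (hA : 0 ≤ A) (hδ : 0 < δ) (hL : 1 ≤ L)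
    (hAL : A * (4 / δ) ^ σ ≤ L) (hs : s + 1 ≤ σ) (hn : 1 / 4 * δ * L ≤ n) :
    A / ((n : ℝ) + 1) ^ σ ≤ 1 / L ^ s := by
  have hL0 : 0 < L := one_pos.trans_le hL
  calc A / ((n : ℝ) + 1) ^ σ ≤ A / (1 / 4 * δ * L) ^ σ := by
        gcongr
        linarith
    _ = A * (4 / δ) ^ σ / L ^ σ := by
        rw [show 1 / 4 * δ * L = L / (4 / δ) by field_simp, div_pow, div_div_eq_mul_div]
    _ ≤ L / L ^ σ := by gcongr
    _ = 1 / L ^ ((σ : ℝ) - 1) := by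
      rw [Real.rpow_sub_one hL0.ne', Real.rpow_natCast, one_div_div]
    _ ≤ 1 / L ^ s := by
      gcongr
      linarith

theorem exists_forall_lt_le_abs_log (R : ℝ) {ε : ℝ} (hε : 0 < ε) :
    ∃ h₀ > 0, ∀ h, 0 < h → h < h₀ → h < ε ∧ R ≤ |Real.log h| := by
  have hlog : ∀ᶠ h in nhdsWithin (0 : ℝ) (Set.Ioi 0), R ≤ |Real.log h| :=
    (Filter.tendsto_abs_atBot_atTop.comp Real.tendsto_log_nhdsGT_zero).eventually_ge_atTop R
  have hlt : ∀ᶠ h in nhdsWithin (0 : ℝ) (Set.Ioi 0), h < ε :=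
    (eventually_lt_nhds hε).filter_mono nhdsWithin_le_nhds
  obtain ⟨h₀, hh₀, hsub⟩ := mem_nhdsGT_iff_exists_Ioo_subset.1 (hlt.and hlog)
  exact ⟨h₀, hh₀, fun h h0 hlt => hsub ⟨h0, hlt⟩⟩

-- The constant in front of `|log h|⁻ˢ` must not depend on `δ`, so the excess of `σ` over `s` pays
-- for both `A` and `δ`.
theorem exists_forall_cutoff_error_le {C A s : ℝ} {σ : ℕ} (hC : 0 ≤ C) (hA : 0 ≤ A) (hδ : 0 < δ)
    (hs : s + 1 ≤ σ) :
    ∃ h₀ > 0, ∀ h, 0 < h → h < h₀ → ∀ n : ℕ,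
      1 / 4 * δ * |Real.log h| ≤ n → (n : ℝ) ≤ 1 / 3 * δ * |Real.log h| →
        (n : ℝ) ≤ 2 / h ^ 2 ∧
          C * h ^ 2 + A / ((n : ℝ) + 1) ^ σ ≤ C * h ^ (2 - δ) + 1 / |Real.log h| ^ s := by
  obtain ⟨h₀, hh₀, hsmall⟩ := exists_forall_lt_le_abs_log (max 1 (A * (4 / δ) ^ σ))
    (ε := min 1 (6 / δ)) (by positivity)
  refine ⟨h₀, hh₀, fun h h0 hlt n hlow hup => ?_⟩
  obtain ⟨hlt, hlog⟩ := hsmall h h0 hlt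
  obtain ⟨h1, hhδ⟩ := lt_min_iff.1 hlt
  obtain ⟨hlog1, hlogA⟩ := max_le_iff.1 hlog
  refine ⟨le_two_div_sq_of_le_log h0 h1.le ((lt_div_iff₀ hδ).1 hhδ).le hup, ?_⟩
  gcongr ?_ + ?_
  · gcongr
    rw [← Real.rpow_two]
    exact Real.rpow_le_rpow_of_exponent_ge h0 h1.le (by linarith)
  · exact div_succ_pow_le_one_div_rpow hA hδ hlog1 hlogA hs hlow

theorem exists_forall_cutoff_of_monotone {P : ℝ → ℕ → ℝ → Prop} (hP : ∀ h n, Monotone (P h n))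
    {C : ℝ} {A : ℕ → ℝ} (hC : 0 ≤ C) (hA : ∀ σ, 0 ≤ A σ)
    (hbound : ∀ (N : ℕ) (h : ℝ), 0 < N → Even N → h = √2 * (N : ℝ) ^ (-(1 / 2) : ℝ) →
      ∀ n ≤ N, ∀ σ, P h n (C * h ^ 2 + A σ / ((n : ℝ) + 1) ^ σ)) :
    ∃ C : ℝ, ∀ s : ℝ, ∃ Cs : ℝ, ∀ δ : ℝ, 0 < δ → ∃ h₀ : ℝ, 0 < h₀ ∧
      ∀ (N : ℕ) (h : ℝ), 0 < N → Even N → h = √2 * (N : ℝ) ^ (-(1 / 2) : ℝ) → h < h₀ →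
      ∀ n : ℕ, 1 / 4 * δ * |Real.log h| ≤ n → (n : ℝ) ≤ 1 / 3 * δ * |Real.log h| →
        P h n (C * h ^ (2 - δ) + Cs / |Real.log h| ^ s) := by
  refine ⟨C, fun s => ⟨1, fun δ hδ => ?_⟩⟩
  have hs : s + 1 ≤ (⌈s⌉₊ + 1 : ℕ) := by
    push_cast
    linarith [Nat.le_ceil s]
  obtain ⟨h₀, hh₀, hcutoff⟩ := exists_forall_cutoff_error_le hC (hA _) hδ hs
  refine ⟨h₀, hh₀, fun N h hN hev hh hlt n hlow hup => ?_⟩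
  obtain ⟨M, rfl, hm⟩ := IsMesh.of_eq hN hev hh
  obtain ⟨hle, herror⟩ := hcutoff h hm.pos hlt n hlow hup
  rw [hm.two_div_sq] at hle
  exact hP h n herror (hbound _ h hN hev hh n (by exact_mod_cast hle) _)

end Cutoff

end Kravchuk

theorem theorem4_general (f : ℝ → ℂ) (hf : Kravchuk.IsSmooth f) :
    (∀ t x : ℝ, Summable (Kravchuk.evolutionTerm f t x)) ∧
    ∃ C : ℝ, 0 ≤ C ∧ ∃ A : ℕ → ℝ, (∀ σ, 0 ≤ A σ) ∧
      ∀ (N : ℕ) (h : ℝ), 0 < N → Even N → h = √2 * (N : ℝ) ^ (-(1 / 2) : ℝ) →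
      ∀ nmax : ℕ, nmax ≤ N →
        Kravchuk.SolvesDiscreteSchrodinger h (Kravchuk.discreteEvolution f nmax h) ∧
        ∀ (t : ℝ) (σ : ℕ),
          Kravchuk.MemEll2 h (fun a => Kravchuk.restrict h (Kravchuk.evolution f t) a
            - Kravchuk.discreteEvolution f nmax h t a) ∧
          Kravchuk.ell2Norm h (fun a => Kravchuk.restrict h (Kravchuk.evolution f t) a
            - Kravchuk.discreteEvolution f nmax h t a)
            ≤ C * h ^ 2 + A σ / ((nmax : ℝ) + 1) ^ σ := by
  obtain ⟨F, rfl⟩ := hf.exists_schwartzMap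
  obtain ⟨C, hC, A, hA, herror⟩ :=
    Kravchuk.exists_ell2Norm_evolution_sub_discreteEvolution_le F
  refine ⟨Kravchuk.summable_evolutionTerm F, C, hC, A, hA, fun N h hN hev hh nmax _ => ?_⟩
  obtain ⟨M, -, hm⟩ := Kravchuk.IsMesh.of_eq hN hev hh
  exact ⟨hm.solvesDiscreteSchrodinger F nmax, herror hm nmax⟩

theorem theorem4 (f : ℝ → ℂ) (hf : Kravchuk.IsSmooth f) :
    (∀ t x : ℝ, Summable (Kravchuk.evolutionTerm f t x)) ∧
    ∃ C : ℝ, ∀ s : ℝ, ∃ Cs : ℝ, ∀ δ : ℝ, 0 < δ → ∃ h₀ : ℝ, 0 < h₀ ∧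
      ∀ (N : ℕ) (h : ℝ), 0 < N → Even N → h = √2 * (N : ℝ) ^ (-(1 / 2) : ℝ) → h < h₀ →
      ∀ nmax : ℕ, 1 / 4 * δ * |Real.log h| ≤ nmax → (nmax : ℝ) ≤ 1 / 3 * δ * |Real.log h| →
        Kravchuk.SolvesDiscreteSchrodinger h (Kravchuk.discreteEvolution f nmax h) ∧
        ∀ t : ℝ, 0 ≤ t →
          Kravchuk.MemEll2 h (fun a => Kravchuk.restrict h (Kravchuk.evolution f t) a
            - Kravchuk.discreteEvolution f nmax h t a) ∧
          Kravchuk.ell2Norm h (fun a => Kravchuk.restrict h (Kravchuk.evolution f t) a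
            - Kravchuk.discreteEvolution f nmax h t a)
            ≤ C * h ^ (2 - δ) + Cs / |Real.log h| ^ s := by
  obtain ⟨hsum, C, hC, A, hA, hbound⟩ := theorem4_general f hf
  exact ⟨hsum, Kravchuk.exists_forall_cutoff_of_monotone (P := fun h nmax ε =>
      Kravchuk.SolvesDiscreteSchrodinger h (Kravchuk.discreteEvolution f nmax h) ∧
      ∀ t : ℝ, 0 ≤ t →
        Kravchuk.MemEll2 h (fun a => Kravchuk.restrict h (Kravchuk.evolution f t) a
          - Kravchuk.discreteEvolution f nmax h t a) ∧
        Kravchuk.ell2Norm h (fun a => Kravchuk.restrict h (Kravchuk.evolution f t) a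
          - Kravchuk.discreteEvolution f nmax h t a) ≤ ε)
    (fun _ _ _ _ hle h => h.imp_right fun herror t ht => (herror t ht).imp_right hle.trans')
    hC hA fun N h hN hev hh nmax hle σ =>
      (hbound N h hN hev hh nmax hle).imp_right fun herror t _ => herror t σ⟩
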